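/- All graphs are finite and simple. A graph is locally irregular if any two adjacent vertices have distinct degrees. A decomposition of a graph $G$ is a collection $H_1,\dots,H_k$ of subgraphs of $G$ such that $E(H_1),\dots,E(H_k)$ form a partition of $E(G)$; it is locally irregular if every $H_i$ is locally irregular, and $G$ is decomposable if it has a locally irregular decomposition. For decomposable $G$, the irregular chromatic index $\chi'_{\rm irr}(G)$ is the smallest size $k$ of a locally irregular decomposition of $G$. **Theorem.** Let $G$ be a graph whose vertex set is partitioned into a maximal clique $X=\{v_1,\dots,v_n\}$ and a stable set $Y=V(G)\setminus X$, where $2\le n\le 9$. Let $d_i=|N_G(v_i)\cap Y|$ and suppose that $d_1\ge\cdots\ge d_n$. Then the following holds. (i) If $G$ is isomorphic to $K_2$, $K_3$ or $P_4$ (the path with four vertices), then $G$ is not decomposable. (ii) If $G$ is decomposable, then (a) if $d_1>d_2>\cdots>d_n$, then $\chi'_{\rm irr}(G)=1$; and, if $d_1>d_2>\cdots>d_n$ does not hold, (b) if $\sum_{i=1}^n d_i\ge\lfloor n/2\rfloor$, then $\chi'_{\rm irr}(G)=2$; (c) if $n\in\{8,9\}$, $d_1+d_2+d_3=3$ and $d_2\ge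 1$, then $\chi'_{\rm irr}(G)=2$; (d) if $n=9$ and $d_1=d_2=1$, then $\chi'_{\rm irr}(G)=2$; (e) if none of the conditions of (b), (c), (d) holds, then $\chi'_{\rm irr}(G)=3$. -/

import Mathlib

namespace SimpleGraph

/-- A subgraph is locally irregular if any two of its adjacent vertices have distinct degrees in
it. (On finite graphs `Set.ncard` of the neighbour set is the degree.) -/
def Subgraph.IsLocallyIrregular {V : Type*} {G : SimpleGraph V} (H : G.Subgraph) : Prop :=
  ∀ u v : V, H.Adj u v → (H.neighborSet u).ncard ≠ (H.neighborSet v).ncard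

/-- The subgraphs `H 0, …, H (k-1)` decompose `G`: their edge sets form a partition of the edge
set of `G`. -/
structure IsDecomposition {V : Type*} (G : SimpleGraph V) {k : ℕ} (H : Fin k → G.Subgraph) :
    Prop where
  nonempty : ∀ i, (H i).edgeSet.Nonempty
  disjoint : ∀ i j, i ≠ j → Disjoint (H i).edgeSet (H j).edgeSet
  iUnion_eq : ⋃ i, (H i).edgeSet = G.edgeSet

/-- `G` has a locally irregular decomposition of size `k`. -/
def HasLocallyIrregularDecomposition {V : Type*} (G : SimpleGraph V) (k : ℕ) : Prop :=
  ∃ H : Fin k → G.Subgraph, G.IsDecomposition H ∧ ∀ i, (H i).IsLocallyIrregular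

/-- `G` is decomposable if it admits a locally irregular decomposition. -/
def Decomposable {V : Type*} (G : SimpleGraph V) : Prop :=
  ∃ k : ℕ, G.HasLocallyIrregularDecomposition k

/-- The irregular chromatic index of a decomposable graph: the smallest size of a locally
irregular decomposition. (Only meaningful for decomposable graphs.) -/
noncomputable def irregularChromaticIndex {V : Type*} (G : SimpleGraph V) : ℕ :=
  sInf {k : ℕ | G.HasLocallyIrregularDecomposition k}

/-- `G(X, Y)` is a split graph: `X` is a maximal clique and its complement `Y` is a stable set. -/
structure IsSplit {V : Type*} (G : SimpleGraph V) (X Y : Set V) : Prop where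
  maximal_isClique : Maximal G.IsClique X
  isIndepSet : G.IsIndepSet Y
  eq_compl : Y = Xᶜ

/-- The number of neighbours of `v` in the set `Y`. -/
noncomputable def degreeInto {V : Type*} (G : SimpleGraph V) (v : V) (Y : Set V) : ℕ :=
  (G.neighborSet v ∩ Y).ncard

end SimpleGraph

/-! A decomposition is treated as an edge colouring, and the argument turns on the degrees of clique
vertices in each colour. If the `d i` are distinct, `G` itself is locally irregular: a vertex of `Y`
has fewer than `n` neighbours by maximality of the clique. If `d i = d j`, two adjacent vertices
have equal degree and one colour is not enough.

Two colours suffice for large sums. Put `h = n / 2`, arrange the clique in positions `0, …, n - 1`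
and apply `thresholdColour`. Inside the clique, colour `0` gives degrees `h, …, 2h - 1` to positions
below `h` and `h, h - 1, …` to the others; the only conflict is the edge between positions `0` and
`h`. Outer edges get colour `0` at positions below `h` and colour `1` elsewhere. The conflict
disappears once the numbers `p + d`, for `p < h`, are distinct and positive. Comparing with `1 + ⋯ +
h`, this needs the `d` placed there to sum to at least `h`; `exists_arrangement` shows that for `h ≤
4` this is enough. The cases of (c) and (d) with a smaller sum have explicit perturbed colourings.

In the remaining decomposable cases `n ≥ 4`, and `d` is `(k, 0, …, 0)` with `k < h`, or `(1, 1, 0,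
…, 0)` with `6 ≤ n ≤ 8`. Three colours suffice: `threeColour` puts the conflicting edge into a
two-edge path of its own. Two colours do not: any two clique vertices without outer neighbours are
adjacent in one of the colours, and their two degrees add up to `n - 1`, so their degrees in the
first colour are distinct. This almost determines the degree sequence. The Erdős–Gallai inequality
`sum_rowSum_le` and the constraints at the one or two special vertices leave a finite check with no
solution. -/

namespace SimpleGraph

/-! ### Decompositions and the irregular chromatic index. -/

section Decomposition

/-- Discarding the subgraphs without edges turns an irregular edge colouring into a
decomposition. -/
theorem exists_hasLocallyIrregularDecomposition_le {V : Type*} {G : SimpleGraph V} {k : ℕ}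
    (H : Fin k → G.Subgraph)
    (hdisj : ∀ i j, i ≠ j → Disjoint (H i).edgeSet (H j).edgeSet)
    (hU : ⋃ i, (H i).edgeSet = G.edgeSet) (hirr : ∀ i, (H i).IsLocallyIrregular) :
    ∃ l ≤ k, G.HasLocallyIrregularDecomposition l := by
  classical
  let S := {i : Fin k // (H i).edgeSet.Nonempty}
  let e := (Fintype.equivFin S).symm
  refine ⟨Fintype.card S, ?_, fun i => H (e i).1, ⟨?_, ?_, ?_⟩, ?_⟩
  · simpa using Fintype.card_subtype_le (fun i : Fin k => (H i).edgeSet.Nonempty)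
  · exact fun i => (e i).2
  · intro i j hij
    exact hdisj _ _ fun h => hij (e.injective (Subtype.ext h))
  · rw [← hU]
    ext x
    simp only [Set.mem_iUnion]
    constructor
    · rintro ⟨i, hi⟩
      exact ⟨_, hi⟩
    · rintro ⟨i, hi⟩
      exact ⟨e.symm ⟨i, ⟨x, hi⟩⟩, by simpa using hi⟩
  · exact fun i => hirr _

theorem not_hasLocallyIrregularDecomposition_zero {V : Type*} {G : SimpleGraph V} {a b : V}
    (hab : G.Adj a b) : ¬ G.HasLocallyIrregularDecomposition 0 := by
  rintro ⟨H, hH, -⟩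
  have : s(a, b) ∈ ⋃ i, (H i).edgeSet := by rw [hH.iUnion_eq]; exact hab
  simp at this

/-- Every edge lies in one of the subgraphs of a decomposition. -/
theorem IsDecomposition.exists_adj {V : Type*} {G : SimpleGraph V} {k : ℕ}
    {H : Fin k → G.Subgraph} (hH : G.IsDecomposition H) {a b : V} (hab : G.Adj a b) :
    ∃ i, (H i).Adj a b := by
  have : s(a, b) ∈ ⋃ i, (H i).edgeSet := by rw [hH.iUnion_eq]; exact hab
  simpa using this

theorem IsDecomposition.eq_of_adj {V : Type*} {G : SimpleGraph V} {k : ℕ}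
    {H : Fin k → G.Subgraph} (hH : G.IsDecomposition H) {a b : V} {i j : Fin k}
    (hi : (H i).Adj a b) (hj : (H j).Adj a b) : i = j := by
  by_contra hij
  exact Set.disjoint_left.1 (hH.disjoint i j hij)
    (show s(a, b) ∈ (H i).edgeSet from hi) hj

theorem ncard_neighborSet_ne_of_hasLocallyIrregularDecomposition_one {V : Type*}
    {G : SimpleGraph V} (h : G.HasLocallyIrregularDecomposition 1) {a b : V} (hab : G.Adj a b) :
    (G.neighborSet a).ncard ≠ (G.neighborSet b).ncard := by
  obtain ⟨H, hH, hirr⟩ := h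
  have key : ∀ u w, (H 0).Adj u w ↔ G.Adj u w := by
    intro u w
    refine ⟨fun h => h.adj_sub, fun h => ?_⟩
    obtain ⟨i, hi⟩ := hH.exists_adj h
    rwa [Subsingleton.elim 0 i]
  have hs : ∀ u, (H 0).neighborSet u = G.neighborSet u := by
    intro u; ext w; simp [key]
  have := hirr 0 a b ((key a b).2 hab)
  rwa [hs, hs] at this

/-- The existence hypothesis also keeps `sInf` away from its default value `0` on the empty set. -/
theorem irregularChromaticIndex_eq {V : Type*} {G : SimpleGraph V} {k : ℕ}
    (hle : ∃ l ≤ k, G.HasLocallyIrregularDecomposition l)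
    (hlt : ∀ l < k, ¬ G.HasLocallyIrregularDecomposition l) :
    G.irregularChromaticIndex = k := by
  obtain ⟨l, hl, h⟩ := hle
  refine le_antisymm ((Nat.sInf_le h).trans hl) ?_
  by_contra! hc
  exact hlt _ hc (Nat.sInf_mem (s := {k | G.HasLocallyIrregularDecomposition k}) ⟨l, h⟩)

end Decomposition

/-! ### The undecomposable graphs `K_2`, `K_3` and `P_4`. -/

section Undecomposable

/-- In a locally irregular decomposition no edge is isolated in its subgraph. -/
theorem Subgraph.IsLocallyIrregular.exists_adj {V : Type*} {G : SimpleGraph V}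
    {H : G.Subgraph} (hH : H.IsLocallyIrregular) {a b : V} (hab : H.Adj a b) :
    ∃ c, (c ≠ b ∧ H.Adj a c) ∨ (c ≠ a ∧ H.Adj b c) := by
  by_contra! hc
  refine hH a b hab ?_
  have h1 : H.neighborSet a = {b} := by
    ext c
    simp only [Subgraph.mem_neighborSet, Set.mem_singleton_iff]
    refine ⟨fun h => ?_, fun h => h ▸ hab⟩
    by_contra hcb
    exact (hc c).1 hcb h
  have h2 : H.neighborSet b = {a} := by
    ext c
    simp only [Subgraph.mem_neighborSet, Set.mem_singleton_iff]
    refine ⟨fun h => ?_, fun h => h ▸ hab.symm⟩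
    by_contra hcb
    exact (hc c).2 hcb h
  rw [h1, h2, Set.ncard_singleton, Set.ncard_singleton]

theorem not_decomposable_of_edge {V : Type*} {G : SimpleGraph V} {a b : V}
    (hE : G.edgeSet = {s(a, b)}) : ¬ G.Decomposable := by
  have hadj : ∀ x y, G.Adj x y ↔ s(x, y) = s(a, b) := fun x y => by
    rw [← mem_edgeSet, hE, Set.mem_singleton_iff]
  rintro ⟨k, H, hH, hirr⟩
  have hab := (hadj a b).2 rfl
  obtain ⟨i, hi⟩ := hH.exists_adj hab
  obtain ⟨c, ⟨hc, h⟩ | ⟨hc, h⟩⟩ := (hirr i).exists_adj hi <;>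
  · have h1 := (hadj _ _).1 h.adj_sub
    have h2 := hab.ne
    simp only [Sym2.eq_iff] at h1
    grind

/-- No edge is alone in its class, so every edge shares its class with another one; with three edges
this forces a single class, which is a regular triangle. -/
theorem not_decomposable_of_triangle {V : Type*} {G : SimpleGraph V} {a b c : V}
    (hE : G.edgeSet = {s(a, b), s(b, c), s(c, a)}) : ¬ G.Decomposable := by
  have hadj : ∀ x y, G.Adj x y ↔ s(x, y) = s(a, b) ∨ s(x, y) = s(b, c) ∨ s(x, y) = s(c, a) :=
    fun x y => by
      rw [← mem_edgeSet, hE, Set.mem_insert_iff, Set.mem_insert_iff, Set.mem_singleton_iff]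
  simp only [Sym2.eq_iff] at hadj
  rintro ⟨k, H, hH, hirr⟩
  have hab : G.Adj a b := by grind
  have hbc : G.Adj b c := by grind
  have hca : G.Adj c a := by grind
  have n1 := hab.ne
  have n2 := hbc.ne
  have n3 := hca.ne
  obtain ⟨i, hi⟩ := hH.exists_adj hab
  obtain ⟨j, hj⟩ := hH.exists_adj hbc
  obtain ⟨l, hl⟩ := hH.exists_adj hca
  -- Stated for a generic labelling so that it can be applied to all three rotations of the
  -- triangle.
  have two : ∀ (i j l : Fin k) (x y z : V), G.Adj x z → x ≠ y → x ≠ z → y ≠ z →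
      (∀ w, G.Adj x w → w = y ∨ w = z) → (∀ w, G.Adj y w → w = x ∨ w = z) →
      (H i).Adj x y → (H j).Adj y z → (H l).Adj z x → i = j ∨ i = l := by
    intro i j l x y z _ _ _ _ hx hy hi hj hl
    obtain ⟨w, ⟨hw, h⟩ | ⟨hw, h⟩⟩ := (hirr i).exists_adj hi
    · rcases hx w h.adj_sub with rfl | rfl
      · exact absurd rfl hw
      · exact Or.inr (hH.eq_of_adj h hl.symm)
    · rcases hy w h.adj_sub with rfl | rfl
      · exact absurd rfl hw
      · exact Or.inl (hH.eq_of_adj h hj)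
  have e1 := two i j l a b c hca.symm n1 n3.symm n2 (by grind) (by grind) hi hj hl
  have e2 := two j l i b c a hab.symm n2 n1.symm n3 (by grind) (by grind) hj hl hi
  have e3 := two l i j c a b hbc.symm n3 n2.symm n1 (by grind) (by grind) hl hi hj
  have hij : i = j := by grind
  have hil : i = l := by grind
  subst hij hil
  refine hirr i a b hi ?_
  have h1 : (H i).neighborSet a = {b, c} := by
    ext w
    simp only [Subgraph.mem_neighborSet, Set.mem_insert_iff, Set.mem_singleton_iff]
    refine ⟨fun h => ?_, ?_⟩
    · have := h.adj_sub; grind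
    · rintro (rfl | rfl)
      exacts [hi, hl.symm]
  have h2 : (H i).neighborSet b = {a, c} := by
    ext w
    simp only [Subgraph.mem_neighborSet, Set.mem_insert_iff, Set.mem_singleton_iff]
    refine ⟨fun h => ?_, ?_⟩
    · have := h.adj_sub; grind
    · rintro (rfl | rfl)
      exacts [hi.symm, hj]
  rw [h1, h2, Set.ncard_pair n2, Set.ncard_pair n3.symm]

/-- Each end edge can only be accompanied by the middle edge, so all edges share a class; there both
ends of the middle edge have degree two. -/
theorem not_decomposable_of_path {V : Type*} {G : SimpleGraph V} {a b c d : V}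
    (hac : a ≠ c) (had : a ≠ d) (hbd : b ≠ d)
    (hE : G.edgeSet = {s(a, b), s(b, c), s(c, d)}) : ¬ G.Decomposable := by
  have hadj : ∀ x y, G.Adj x y ↔ s(x, y) = s(a, b) ∨ s(x, y) = s(b, c) ∨ s(x, y) = s(c, d) :=
    fun x y => by
      rw [← mem_edgeSet, hE, Set.mem_insert_iff, Set.mem_insert_iff, Set.mem_singleton_iff]
  simp only [Sym2.eq_iff] at hadj
  rintro ⟨k, H, hH, hirr⟩
  have hab : G.Adj a b := by grind
  have hbc : G.Adj b c := by grind
  have hcd : G.Adj c d := by grind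
  have n1 := hab.ne
  have n2 := hbc.ne
  have n3 := hcd.ne
  obtain ⟨i, hi⟩ := hH.exists_adj hab
  obtain ⟨j, hj⟩ := hH.exists_adj hbc
  obtain ⟨l, hl⟩ := hH.exists_adj hcd
  have hij : i = j := by
    obtain ⟨w, ⟨hw, h⟩ | ⟨hw, h⟩⟩ := (hirr i).exists_adj hi
    · have := h.adj_sub; grind
    · have : w = c := by have := h.adj_sub; grind
      subst this
      exact hH.eq_of_adj h hj
  have hlj : l = j := by
    obtain ⟨w, ⟨hw, h⟩ | ⟨hw, h⟩⟩ := (hirr l).exists_adj hl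
    · have : w = b := by have := h.adj_sub; grind
      subst this
      exact hH.eq_of_adj h hj.symm
    · have := h.adj_sub; grind
  subst hij hlj
  refine hirr l b c hj ?_
  have h1 : (H l).neighborSet b = {a, c} := by
    ext w
    simp only [Subgraph.mem_neighborSet, Set.mem_insert_iff, Set.mem_singleton_iff]
    refine ⟨fun h => ?_, ?_⟩
    · have := h.adj_sub; grind
    · rintro (rfl | rfl)
      exacts [hi.symm, hj]
  have h2 : (H l).neighborSet c = {b, d} := by
    ext w
    simp only [Subgraph.mem_neighborSet, Set.mem_insert_iff, Set.mem_singleton_iff]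
    refine ⟨fun h => ?_, ?_⟩
    · have := h.adj_sub; grind
    · rintro (rfl | rfl)
      exacts [hj.symm, hl]
  rw [h1, h2, Set.ncard_pair hac, Set.ncard_pair hbd]

/-- An isomorphism identifies the edge sets. -/
theorem Iso.edgeSet_eq_image {V W : Type*} {G : SimpleGraph V} {G' : SimpleGraph W}
    (f : G ≃g G') : G.edgeSet = Sym2.map f.symm '' G'.edgeSet := by
  ext x
  induction x using Sym2.ind with
  | _ a b =>
    constructor
    · intro h
      exact ⟨s(f a, f b), f.map_adj_iff.2 h, by simp⟩
    · rintro ⟨y, hy, hyx⟩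
      rw [← hyx]
      induction y using Sym2.ind with
      | _ c d => exact f.symm.map_adj_iff.2 hy

theorem not_decomposable_of_iso {V : Type*} {G : SimpleGraph V}
    (h : Nonempty (G ≃g completeGraph (Fin 2)) ∨ Nonempty (G ≃g completeGraph (Fin 3)) ∨
      Nonempty (G ≃g pathGraph 4)) : ¬ G.Decomposable := by
  rcases h with ⟨⟨f⟩⟩ | ⟨⟨f⟩⟩ | ⟨⟨f⟩⟩
  · have h0 : (completeGraph (Fin 2)).edgeSet = {s(0, 1)} := by
      ext x
      induction x using Sym2.ind with
      | _ a b => revert a b; simp [completeGraph, Fin.forall_fin_succ]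
    refine not_decomposable_of_edge (a := f.symm 0) (b := f.symm 1) ?_
    rw [f.edgeSet_eq_image, h0]
    simp
  · have h0 : (completeGraph (Fin 3)).edgeSet = {s(0, 1), s(1, 2), s(2, 0)} := by
      ext x
      induction x using Sym2.ind with
      | _ a b => revert a b; simp [completeGraph, Fin.forall_fin_succ]
    refine not_decomposable_of_triangle (a := f.symm 0) (b := f.symm 1) (c := f.symm 2) ?_
    rw [f.edgeSet_eq_image, h0]
    simp [Set.image_insert_eq]
  · have h0 : (pathGraph 4).edgeSet = {s(0, 1), s(1, 2), s(2, 3)} := by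
      ext x
      induction x using Sym2.ind with
      | _ a b => revert a b; simp [pathGraph_adj, Fin.forall_fin_succ]
    refine not_decomposable_of_path (a := f.symm 0) (b := f.symm 1) (c := f.symm 2)
      (d := f.symm 3) (by simp) (by simp) (by simp) ?_
    rw [f.edgeSet_eq_image, h0]
    simp [Set.image_insert_eq]

end Undecomposable

/-! ### From colourings of a split graph to decompositions. -/

section Colouring

/-- The colour class `a` of the colouring of a split graph in which the edge `v i — v j` of the
clique has colour `c i j`, and all edges from `v i` to `Y` have colour `e i`. -/
def colourSubgraph {V κ : Type*} {n : ℕ} (G : SimpleGraph V) (Y : Set V) (v : Fin n → V)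
    (c : Fin n → Fin n → κ) (hc : ∀ i j, c i j = c j i) (e : Fin n → κ) (a : κ) :
    G.Subgraph where
  verts := Set.univ
  Adj u w := G.Adj u w ∧ ((∃ i j, u = v i ∧ w = v j ∧ c i j = a) ∨
    (∃ i, u = v i ∧ w ∈ Y ∧ e i = a) ∨ (∃ i, w = v i ∧ u ∈ Y ∧ e i = a))
  adj_sub h := h.1
  edge_vert _ := Set.mem_univ _
  symm := by
    constructor
    rintro u w ⟨h, ⟨i, j, hi, hj, hij⟩ | h' | h'⟩
    · exact ⟨h.symm, Or.inl ⟨j, i, hj, hi, hc i j ▸ hij⟩⟩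
    · exact ⟨h.symm, Or.inr (Or.inr h')⟩
    · exact ⟨h.symm, Or.inr (Or.inl h')⟩

/-- The degree of `v i` in the colour class `a` of `colourSubgraph`, when `v i` has `d i`
neighbours outside the clique. -/
def colourDegree {κ : Type*} [DecidableEq κ] {n : ℕ} (c : Fin n → Fin n → κ) (e : Fin n → κ)
    (d : Fin n → ℕ) (a : κ) (i : Fin n) : ℕ :=
  (Finset.univ.filter fun j => j ≠ i ∧ c i j = a).card + if e i = a then d i else 0

theorem IsSplit.adj {V : Type*} {G : SimpleGraph V} {X Y : Set V} (hG : G.IsSplit X Y) {n : ℕ}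
    {v : Fin n → V} (hv : Function.Injective v) (hX : Set.range v = X) {i j : Fin n}
    (hij : i ≠ j) : G.Adj (v i) (v j) :=
  hG.maximal_isClique.1 (hX ▸ Set.mem_range_self i) (hX ▸ Set.mem_range_self j) (hv.ne hij)

theorem IsSplit.notMem {V : Type*} {G : SimpleGraph V} {X Y : Set V} (hG : G.IsSplit X Y) {n : ℕ}
    {v : Fin n → V} (hX : Set.range v = X) (i : Fin n) : v i ∉ Y := by
  rw [hG.eq_compl]
  exact fun h => h (hX ▸ Set.mem_range_self i)

theorem IsSplit.exists_or_mem {V : Type*} {G : SimpleGraph V} {X Y : Set V} (hG : G.IsSplit X Y)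
    {n : ℕ} {v : Fin n → V} (hX : Set.range v = X) (u : V) : (∃ i, u = v i) ∨ u ∈ Y := by
  by_cases h : u ∈ X
  · rw [← hX] at h
    obtain ⟨i, rfl⟩ := h
    exact Or.inl ⟨i, rfl⟩
  · exact Or.inr (by rw [hG.eq_compl]; exact h)

theorem IsSplit.not_adj {V : Type*} {G : SimpleGraph V} {X Y : Set V} (hG : G.IsSplit X Y)
    {x y : V} (hx : x ∈ Y) (hy : y ∈ Y) : ¬ G.Adj x y :=
  fun h => hG.isIndepSet hx hy h.ne h

/-- By maximality of the clique, no vertex outside it is adjacent to all of it. -/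
theorem IsSplit.exists_not_adj {V : Type*} {G : SimpleGraph V} {X Y : Set V}
    (hG : G.IsSplit X Y) {n : ℕ} {v : Fin n → V} (hX : Set.range v = X) {y : V} (hy : y ∈ Y) :
    ∃ i, ¬ G.Adj (v i) y := by
  by_contra! h
  have hcl : G.IsClique (insert y X) := by
    refine hG.maximal_isClique.1.insert fun x hx _ => ?_
    rw [← hX] at hx
    obtain ⟨i, rfl⟩ := hx
    exact (h i).symm
  have : y ∈ X := hG.maximal_isClique.2 hcl (Set.subset_insert _ _) (Set.mem_insert _ _)
  rw [hG.eq_compl] at hy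
  exact hy this

theorem IsSplit.neighborSet_colourSubgraph {V κ : Type*} [DecidableEq κ] {G : SimpleGraph V}
    {X Y : Set V} (hG : G.IsSplit X Y) {n : ℕ} {v : Fin n → V} (hv : Function.Injective v)
    (hX : Set.range v = X) (c : Fin n → Fin n → κ) (hc : ∀ i j, c i j = c j i) (e : Fin n → κ)
    (a : κ) (i : Fin n) :
    (colourSubgraph G Y v c hc e a).neighborSet (v i) =
      v '' {j | j ≠ i ∧ c i j = a} ∪ if e i = a then G.neighborSet (v i) ∩ Y else ∅ := by
  ext w
  simp only [Subgraph.mem_neighborSet, colourSubgraph, Set.mem_union, Set.mem_image,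
    Set.mem_ofPred_eq]
  constructor
  · rintro ⟨h, ⟨i', j, hi, rfl, hij⟩ | ⟨i', hi, hw, he⟩ | ⟨i', hi, hw, he⟩⟩
    · obtain rfl := hv hi
      refine Or.inl ⟨j, ⟨?_, hij⟩, rfl⟩
      rintro rfl
      exact h.ne rfl
    · obtain rfl := hv hi
      right
      rw [if_pos he]
      exact ⟨h, hw⟩
    · exact absurd hw (hG.notMem hX i)
  · rintro (⟨j, ⟨hj, hij⟩, rfl⟩ | h)
    · exact ⟨hG.adj hv hX hj.symm, Or.inl ⟨i, j, rfl, rfl, hij⟩⟩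
    · split_ifs at h with he
      · exact ⟨h.1, Or.inr (Or.inl ⟨i, rfl, h.2, he⟩)⟩
      · exact absurd h (Set.notMem_empty _)

theorem IsSplit.ncard_neighborSet_colourSubgraph {V κ : Type*} [Finite V] [DecidableEq κ]
    {G : SimpleGraph V}
    {X Y : Set V} (hG : G.IsSplit X Y) {n : ℕ} {v : Fin n → V} (hv : Function.Injective v)
    (hX : Set.range v = X) {d : Fin n → ℕ} (hd : ∀ i, d i = G.degreeInto (v i) Y)
    (c : Fin n → Fin n → κ) (hc : ∀ i j, c i j = c j i) (e : Fin n → κ)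
    (a : κ) (i : Fin n) :
    ((colourSubgraph G Y v c hc e a).neighborSet (v i)).ncard = colourDegree c e d a i := by
  rw [hG.neighborSet_colourSubgraph hv hX, Set.ncard_union_eq ?_ (Set.toFinite _) (Set.toFinite _),
    Set.ncard_image_of_injective _ hv, colourDegree]
  · congr 1
    · rw [← Set.ncard_coe_finset]
      simp
    · split_ifs
      · exact (hd i).symm
      · exact Set.ncard_empty _
  · rw [Set.disjoint_left]
    rintro _ ⟨j, -, rfl⟩ h
    split_ifs at h
    · exact hG.notMem hX j h.2
    · exact h

theorem IsSplit.ncard_neighborSet_colourSubgraph_of_mem {V κ : Type*}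
    {G : SimpleGraph V}
    {X Y : Set V} (hG : G.IsSplit X Y) {n : ℕ} {v : Fin n → V} (hv : Function.Injective v)
    (hX : Set.range v = X)
    (c : Fin n → Fin n → κ) (hc : ∀ i j, c i j = c j i) (e : Fin n → κ)
    (a : κ) {y : V} (hy : y ∈ Y) :
    ((colourSubgraph G Y v c hc e a).neighborSet y).ncard =
      {j | e j = a ∧ G.Adj (v j) y}.ncard := by
  rw [← Set.ncard_image_of_injective _ hv]
  congr 1
  ext w
  simp only [Subgraph.mem_neighborSet, colourSubgraph, Set.mem_image, Set.mem_ofPred_eq]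
  constructor
  · rintro ⟨h, ⟨i', j, rfl, rfl, hij⟩ | ⟨i', rfl, hw, he⟩ | ⟨i', rfl, hw, he⟩⟩
    · exact absurd hy (hG.notMem hX _)
    · exact absurd hy (hG.notMem hX _)
    · exact ⟨i', ⟨he, h.symm⟩, rfl⟩
  · rintro ⟨j, ⟨he, h⟩, rfl⟩
    exact ⟨h.symm, Or.inr (Or.inr ⟨j, rfl, hy, he⟩)⟩

/-- A colouring of a split graph whose colour classes are locally irregular, given by numerical
conditions. -/
theorem IsSplit.exists_decomposition_of_colouring {V : Type*} [Finite V]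
    {G : SimpleGraph V}
    {X Y : Set V} (hG : G.IsSplit X Y) {n : ℕ} {v : Fin n → V} (hv : Function.Injective v)
    (hX : Set.range v = X) {d : Fin n → ℕ} (hd : ∀ i, d i = G.degreeInto (v i) Y) {k : ℕ}
    (c : Fin n → Fin n → Fin k) (hc : ∀ i j, c i j = c j i) (e : Fin n → Fin k)
    (hcl : ∀ i j, i ≠ j → colourDegree c e d (c i j) i ≠ colourDegree c e d (c i j) j)
    (hY : ∀ i, ∀ y ∈ Y, G.Adj (v i) y →
      colourDegree c e d (e i) i ≠ {j | e j = e i ∧ G.Adj (v j) y}.ncard) :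
    ∃ l ≤ k, G.HasLocallyIrregularDecomposition l := by
  refine exists_hasLocallyIrregularDecomposition_le (colourSubgraph G Y v c hc e) ?_ ?_ ?_
  · intro a b hab
    rw [Set.disjoint_left]
    intro x
    induction x using Sym2.ind with
    | _ u w =>
      rintro ⟨h, ⟨i, j, rfl, rfl, h1⟩ | ⟨i, rfl, hw, h1⟩ | ⟨i, rfl, hw, h1⟩⟩
        ⟨-, ⟨i', j', hi, hj, h2⟩ | ⟨i', hi, hw', h2⟩ | ⟨i', hi, hw', h2⟩⟩
      · rw [← hv hi, ← hv hj] at h2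
        exact hab (h1.symm.trans h2)
      · exact hG.notMem hX _ hw'
      · exact hG.notMem hX _ hw'
      · exact hG.notMem hX _ (hj ▸ hw)
      · rw [← hv hi] at h2
        exact hab (h1.symm.trans h2)
      · exact hG.notMem hX _ hw'
      · exact hG.notMem hX _ (hi ▸ hw)
      · exact hG.notMem hX _ hw'
      · rw [← hv hi] at h2
        exact hab (h1.symm.trans h2)
  · ext x
    induction x using Sym2.ind with
    | _ u w =>
      simp only [Set.mem_iUnion, Subgraph.mem_edgeSet, mem_edgeSet]
      refine ⟨fun ⟨a, ha⟩ => ha.1, fun h => ?_⟩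
      obtain ⟨i, rfl⟩ | hu := hG.exists_or_mem hX u
      · obtain ⟨j, rfl⟩ | hw := hG.exists_or_mem hX w
        · exact ⟨c i j, h, Or.inl ⟨i, j, rfl, rfl, rfl⟩⟩
        · exact ⟨e i, h, Or.inr (Or.inl ⟨i, rfl, hw, rfl⟩)⟩
      · obtain ⟨j, rfl⟩ | hw := hG.exists_or_mem hX w
        · exact ⟨e j, h, Or.inr (Or.inr ⟨j, rfl, hu, rfl⟩)⟩
        · exact absurd h (hG.not_adj hu hw)
  · rintro a u w ⟨h, ⟨i, j, rfl, rfl, h1⟩ | ⟨i, rfl, hw, h1⟩ | ⟨i, rfl, hw, h1⟩⟩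
    · rw [hG.ncard_neighborSet_colourSubgraph hv hX hd,
        hG.ncard_neighborSet_colourSubgraph hv hX hd, ← h1]
      refine hcl i j ?_
      rintro rfl
      exact h.ne rfl
    · rw [hG.ncard_neighborSet_colourSubgraph hv hX hd,
        hG.ncard_neighborSet_colourSubgraph_of_mem hv hX _ _ _ _ hw, ← h1]
      exact hY i w hw h
    · rw [hG.ncard_neighborSet_colourSubgraph hv hX hd,
        hG.ncard_neighborSet_colourSubgraph_of_mem hv hX _ _ _ _ hw, ← h1]
      exact (hY i u hw h.symm).symm

theorem IsSplit.one_le_of_adj {V : Type*} [Finite V] {G : SimpleGraph V} {Y : Set V} {n : ℕ}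
    {v : Fin n → V} {d : Fin n → ℕ} (hd : ∀ i, d i = G.degreeInto (v i) Y) {i : Fin n} {y : V}
    (hy : y ∈ Y) (h : G.Adj (v i) y) : 1 ≤ d i := by
  rw [hd, degreeInto, Nat.one_le_iff_ne_zero]
  exact Set.ncard_ne_zero_of_mem (a := y) ⟨h, hy⟩ (Set.toFinite _)

/-- A version of `IsSplit.exists_decomposition_of_colouring` whose conditions involve the numbers
`d i` only. -/
theorem IsSplit.exists_decomposition_of_colourDegree {V : Type*} [Finite V]
    {G : SimpleGraph V}
    {X Y : Set V} (hG : G.IsSplit X Y) {n : ℕ} {v : Fin n → V} (hv : Function.Injective v)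
    (hX : Set.range v = X) {d : Fin n → ℕ} (hd : ∀ i, d i = G.degreeInto (v i) Y) {k : ℕ}
    (c : Fin n → Fin n → Fin k) (hc : ∀ i j, c i j = c j i) (e : Fin n → Fin k)
    (hcl : ∀ i j, i ≠ j → colourDegree c e d (c i j) i ≠ colourDegree c e d (c i j) j)
    (hY : ∀ i, 1 ≤ d i →
      (Finset.univ.filter fun j => e j = e i ∧ 1 ≤ d j).card < colourDegree c e d (e i) i) :
    ∃ l ≤ k, G.HasLocallyIrregularDecomposition l := by
  refine hG.exists_decomposition_of_colouring hv hX hd c hc e hcl fun i y hy h => ?_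
  refine (lt_of_le_of_lt ?_ (hY i (one_le_of_adj hd hy h))).ne'
  rw [← Set.ncard_coe_finset]
  refine Set.ncard_le_ncard (fun j hj => ?_) (Set.toFinite _)
  simpa using ⟨hj.1, one_le_of_adj hd hy hj.2⟩

/-- The degree of a clique vertex of a split graph. -/
theorem IsSplit.ncard_neighborSet {V : Type*} [Finite V] {G : SimpleGraph V}
    {X Y : Set V} (hG : G.IsSplit X Y) {n : ℕ} {v : Fin n → V} (hv : Function.Injective v)
    (hX : Set.range v = X) {d : Fin n → ℕ} (hd : ∀ i, d i = G.degreeInto (v i) Y) (i : Fin n) :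
    (G.neighborSet (v i)).ncard = n - 1 + d i := by
  have h := hG.ncard_neighborSet_colourSubgraph hv hX hd (κ := Fin 1) (fun _ _ => 0)
    (fun _ _ => rfl) (fun _ => 0) 0 i
  simp only [colourDegree, and_true, if_true, Finset.filter_ne', Finset.card_erase_of_mem,
    Finset.mem_univ, Finset.card_univ, Fintype.card_fin] at h
  rw [← h]
  congr 1
  ext w
  simp only [mem_neighborSet, Subgraph.mem_neighborSet, colourSubgraph]
  refine ⟨fun h => ⟨h, ?_⟩, fun h => h.1⟩
  obtain ⟨j, rfl⟩ | hw := hG.exists_or_mem hX w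
  · exact Or.inl ⟨i, j, rfl, rfl, trivial⟩
  · exact Or.inr (Or.inl ⟨i, rfl, hw, trivial⟩)

/-- If the numbers `d i` are distinct, the split graph is locally irregular. -/
theorem IsSplit.exists_decomposition_one {V : Type*} [Finite V]
    {G : SimpleGraph V}
    {X Y : Set V} (hG : G.IsSplit X Y) {n : ℕ} {v : Fin n → V} (hv : Function.Injective v)
    (hX : Set.range v = X) {d : Fin n → ℕ} (hd : ∀ i, d i = G.degreeInto (v i) Y)
    (hinj : Function.Injective d) : ∃ l ≤ 1, G.HasLocallyIrregularDecomposition l := by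
  have hD : ∀ i, colourDegree (fun _ _ => (0 : Fin 1)) (fun _ => 0) d 0 i = n - 1 + d i := by
    intro i
    simp [colourDegree, Finset.filter_ne', Finset.card_erase_of_mem]
  refine hG.exists_decomposition_of_colouring hv hX hd (k := 1) (fun _ _ => 0)
    (fun _ _ => rfl) (fun _ => 0) ?_ ?_
  · intro i j hij h
    rw [hD, hD] at h
    exact hij (hinj (by omega))
  · intro i y hy h
    rw [hD]
    have h1 := one_le_of_adj hd hy h
    -- The outer vertex misses some `v j`, so its degree is below `n`, while `v i` has degree at
    -- least `n`.
    obtain ⟨j, hj⟩ := hG.exists_not_adj hX hy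
    have h2 : {j | (0 : Fin 1) = 0 ∧ G.Adj (v j) y}.ncard < (Set.univ : Set (Fin n)).ncard :=
      Set.ncard_lt_ncard ⟨Set.subset_univ _, fun h => hj (h (Set.mem_univ j)).2⟩
    rw [Set.ncard_univ, Nat.card_fin] at h2
    have h3 : 0 < n := i.pos
    exact fun h => by omega

end Colouring

/-! ### The threshold colouring with two colours. -/

section Threshold

/-- Colour `0` is the threshold graph on `ℕ` with clique `{0, …, h - 1}` in which `p < h` is joined
to `h, …, h + p`; all other pairs have colour `1`. -/
def thresholdColour (h a b : ℕ) : Fin 2 :=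
  if min a b < h ∧ max a b ≤ min a b + h then 0 else 1

theorem thresholdColour_comm (h a b : ℕ) : thresholdColour h a b = thresholdColour h b a := by
  rw [thresholdColour, thresholdColour, min_comm, max_comm]

theorem card_thresholdColour : ∀ n < 10, ∀ i : Fin n,
    (Finset.univ.filter fun j : Fin n => j ≠ i ∧ thresholdColour (n / 2) i j = 0).card =
        (if i.1 < n / 2 then n / 2 + i else 2 * (n / 2) - i) ∧
    (Finset.univ.filter fun j : Fin n => j ≠ i ∧ thresholdColour (n / 2) i j = 1).card =
        n - 1 - (if i.1 < n / 2 then n / 2 + i else 2 * (n / 2) - i) := by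
  decide +kernel

/-- Write `h = n / 2`. In colour `0`, positions `p < h` have distinct degrees `h + p + d p > h`; the
others have degree at most `h` and are pairwise non-adjacent. In colour `1`, positions `q ≥ h` have
strictly increasing degrees `n - 1 - 2h + q + d q`, larger than those of the positions below `h`
joined to them, which are pairwise non-adjacent. An outer vertex has at most `h` edges of colour `0`
and at most `n - h` of colour `1`; a tie is possible only with position `h` when its `d` is `1`, and
`hY` excludes it. -/
theorem IsSplit.exists_decomposition_two_of_threshold {V : Type*} [Finite V]
    {G : SimpleGraph V} {X Y : Set V} (hG : G.IsSplit X Y) {n : ℕ} (hn2 : 2 ≤ n) (hn9 : n ≤ 9)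
    {v : Fin n → V} (hv : Function.Injective v)
    (hX : Set.range v = X) {d : Fin n → ℕ} (hd : ∀ i, d i = G.degreeInto (v i) Y)
    (hS : ∀ i j : Fin n, i.1 < n / 2 → j.1 < n / 2 → i ≠ j → i + d i ≠ j + d j)
    (hS1 : ∀ i : Fin n, i.1 < n / 2 → 1 ≤ i + d i)
    (hT : ∀ i j : Fin n, n / 2 ≤ i.1 → i < j → d i ≤ d j)
    (hY : ∀ i : Fin n, i.1 = n / 2 → d i = 1 → ∀ y ∈ Y, G.Adj (v i) y →
      ∃ j : Fin n, n / 2 ≤ j.1 ∧ ¬ G.Adj (v j) y) :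
    ∃ l ≤ 2, G.HasLocallyIrregularDecomposition l := by
  let c : Fin n → Fin n → Fin 2 := fun i j => thresholdColour (n / 2) i j
  let e : Fin n → Fin 2 := fun i => if i.1 < n / 2 then 0 else 1
  have he : ∀ i, e i = if i.1 < n / 2 then 0 else 1 := fun i => rfl
  have hD0 : ∀ i, colourDegree c e d 0 i =
      if i.1 < n / 2 then n / 2 + i + d i else 2 * (n / 2) - i := by
    intro i
    have h := (card_thresholdColour n (by omega) i).1
    simp only [colourDegree, c, h, he]
    split_ifs <;> simp_all
  have hD1 : ∀ i, colourDegree c e d 1 i =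
      if i.1 < n / 2 then n - 1 - (n / 2 + i) else n - 1 - (2 * (n / 2) - i) + d i := by
    intro i
    have h := (card_thresholdColour n (by omega) i).2
    simp only [colourDegree, c, h, he]
    split_ifs <;> simp_all
  refine hG.exists_decomposition_of_colouring hv hX hd c (fun i j => thresholdColour_comm _ _ _) e
    ?_ ?_
  · have key : ∀ i j : Fin n, i < j →
        colourDegree c e d (c i j) i ≠ colourDegree c e d (c i j) j := by
      intro i j hij
      have h1 := hS i j
      have h2 := hS1 i
      have h3 := hT i j
      have h4 := hij.ne
      have hij' : i.1 < j.1 := hij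
      have h5 := j.2
      by_cases hc : i.1 < n / 2 ∧ j.1 ≤ i.1 + n / 2
      · have : c i j = 0 := by
          simp only [c, thresholdColour]
          rw [if_pos]
          omega
        rw [this, hD0, hD0]
        split_ifs <;> grind
      · have : c i j = 1 := by
          simp only [c, thresholdColour]
          rw [if_neg]
          omega
        rw [this, hD1, hD1]
        split_ifs <;> omega
    intro i j hij
    rcases lt_or_gt_of_ne hij with h | h
    · exact key i j h
    · have : c i j = c j i := thresholdColour_comm _ _ _
      rw [this]
      exact (key j i h).symm
  · intro i y hy hadj
    have hd1 := one_le_of_adj hd hy hadj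
    have hi := i.2
    by_cases h : i.1 < n / 2
    · have hei : e i = 0 := by rw [he, if_pos h]
      rw [hei, hD0, if_pos h]
      have hle : {j | e j = 0 ∧ G.Adj (v j) y}.ncard ≤ n / 2 := by
        calc _ ≤ {j : Fin n | j.1 < n / 2}.ncard := by
              refine Set.ncard_le_ncard (fun j hj => ?_) (Set.toFinite _)
              by_contra hjh
              have := hj.1
              rw [he, if_neg (by simpa using hjh)] at this
              exact absurd this (by decide)
          _ = (Finset.univ.filter fun j : Fin n => j.1 < n / 2).card := by
              rw [← Set.ncard_coe_finset]; simp
          _ ≤ n / 2 := by rw [Fin.card_filter_val_lt]; exact min_le_right _ _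
      omega
    · have hei : e i = 1 := by rw [he, if_neg h]
      rw [hei, hD1, if_neg h]
      have hcard : {j : Fin n | n / 2 ≤ j.1}.ncard = n - n / 2 := by
        have h1 : {j : Fin n | n / 2 ≤ j.1}.ncard =
            (Finset.univ.filter fun j : Fin n => ¬ j.1 < n / 2).card := by
          rw [← Set.ncard_coe_finset]; simp
        have h2 := Finset.card_filter_add_card_filter_not (s := (Finset.univ : Finset (Fin n)))
          (fun j => j.1 < n / 2)
        rw [Fin.card_filter_val_lt, Finset.card_univ, Fintype.card_fin] at h2
        omega
      have hsub : {j | e j = 1 ∧ G.Adj (v j) y} ⊆ {j : Fin n | n / 2 ≤ j.1} := by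
        intro j hj
        by_contra hjh
        have := hj.1
        rw [he, if_pos (by simpa using hjh)] at this
        exact absurd this (by decide)
      have hle := Set.ncard_le_ncard hsub (Set.toFinite _)
      rw [hcard] at hle
      by_cases h2 : i.1 = n / 2 ∧ d i = 1
      · obtain ⟨j, hj, hjy⟩ := hY i h2.1 h2.2 y hy hadj
        have hlt := Set.ncard_lt_ncard (s := {j | e j = 1 ∧ G.Adj (v j) y})
          (t := {j : Fin n | n / 2 ≤ j.1}) ⟨hsub, fun h => hjy (h hj).2⟩
        rw [hcard] at hlt
        omega
      · omega

end Threshold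

/-! ### Arranging the first half of the clique. -/

section Arrangement

/-- At most four numbers whose sum is at least their count can be arranged such that adding the
position to each of them gives distinct positive numbers. -/
theorem exists_arrangement {h : ℕ} (h1 : 1 ≤ h) (h4 : h ≤ 4) (d : Fin h → ℕ) (hd : Antitone d)
    (hsum : h ≤ ∑ i, d i) :
    ∃ σ : Fin h → Fin h, Function.Injective σ ∧ (Function.Injective fun p => p.1 + d (σ p)) ∧
      ∀ p, 1 ≤ p.1 + d (σ p) := by
  interval_cases h
  · refine ⟨![0], ?_⟩
    simp [Function.Injective, Fin.forall_fin_succ] at *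
    omega
  · have h10 : d 1 ≤ d 0 := hd (by decide)
    simp only [Fin.sum_univ_succ, Fin.sum_univ_zero] at hsum
    simp at hsum
    obtain h | h : d 1 ≠ 0 ∨ d 1 = 0 := by omega
    · refine ⟨![1, 0], ?_⟩
      simp [Function.Injective, Fin.forall_fin_succ]
      omega
    · refine ⟨![0, 1], ?_⟩
      simp [Function.Injective, Fin.forall_fin_succ]
      omega
  · have h10 : d 1 ≤ d 0 := hd (by decide)
    have h21 : d 2 ≤ d 1 := hd (by decide)
    simp only [Fin.sum_univ_three] at hsum
    obtain h | h | h | h : d 2 ≠ 0 ∨ (d 2 = 0 ∧ d 1 = 1) ∨ (d 2 = 0 ∧ 2 ≤ d 1) ∨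
        (d 2 = 0 ∧ d 1 = 0) := by omega
    · refine ⟨![2, 1, 0], ?_⟩
      simp [Function.Injective, Fin.forall_fin_succ]
      omega
    · refine ⟨![1, 0, 2], ?_⟩
      simp [Function.Injective, Fin.forall_fin_succ]
      omega
    · refine ⟨![1, 2, 0], ?_⟩
      simp [Function.Injective, Fin.forall_fin_succ]
      omega
    · refine ⟨![0, 1, 2], ?_⟩
      simp [Function.Injective, Fin.forall_fin_succ]
      omega
  · have h10 : d 1 ≤ d 0 := hd (by decide)
    have h21 : d 2 ≤ d 1 := hd (by decide)
    have h32 : d 3 ≤ d 2 := hd (by decide)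
    simp only [Fin.sum_univ_four] at hsum
    -- A zero at position `p` yields the value `p`. So position `0` receives a nonzero number, and
    -- the nonzero numbers are placed to miss the values taken by the zeros.
    obtain h | h | h | h | h | h | h | h : d 3 ≠ 0 ∨ (d 3 = 0 ∧ d 2 = 1 ∧ d 1 = 1) ∨
        (d 3 = 0 ∧ d 2 = 1 ∧ 2 ≤ d 1) ∨ (d 3 = 0 ∧ 2 ≤ d 2) ∨
        (d 3 = 0 ∧ d 2 = 0 ∧ d 1 = 1) ∨ (d 3 = 0 ∧ d 2 = 0 ∧ d 1 = 2) ∨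
        (d 3 = 0 ∧ d 2 = 0 ∧ 3 ≤ d 1) ∨ (d 3 = 0 ∧ d 2 = 0 ∧ d 1 = 0) := by omega
    · refine ⟨![3, 2, 1, 0], ?_⟩
      simp [Function.Injective, Fin.forall_fin_succ]
      omega
    · refine ⟨![2, 1, 0, 3], ?_⟩
      simp [Function.Injective, Fin.forall_fin_succ]
      omega
    · refine ⟨![2, 1, 3, 0], ?_⟩
      simp [Function.Injective, Fin.forall_fin_succ]
      omega
    · refine ⟨![2, 3, 1, 0], ?_⟩
      simp [Function.Injective, Fin.forall_fin_succ]
      omega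
    · refine ⟨![1, 0, 2, 3], ?_⟩
      simp [Function.Injective, Fin.forall_fin_succ]
      omega
    · refine ⟨![1, 2, 0, 3], ?_⟩
      simp [Function.Injective, Fin.forall_fin_succ]
      omega
    · refine ⟨![1, 2, 3, 0], ?_⟩
      simp [Function.Injective, Fin.forall_fin_succ]
      omega
    · refine ⟨![0, 1, 2, 3], ?_⟩
      simp [Function.Injective, Fin.forall_fin_succ]
      omega

end Arrangement

/-! ### Two colours when the sum is at least `n / 2`. -/

section LargeSum

/-- Either each of the first `h` values is at least `1`, or one of them is `0`; then all later
values vanish and the first `h` carry the whole sum. -/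
theorem le_sum_castLE {h n : ℕ} (hn : h ≤ n) {d : Fin n → ℕ} (hd : Antitone d)
    (hsum : h ≤ ∑ i, d i) : h ≤ ∑ i : Fin h, d (Fin.castLE hn i) := by
  obtain ⟨t, rfl⟩ := Nat.exists_eq_add_of_le hn
  rw [Fin.sum_univ_add] at hsum
  by_cases hpos : ∀ i : Fin h, 1 ≤ d (Fin.castLE hn i)
  · calc h = ∑ i : Fin h, 1 := by simp
      _ ≤ _ := Finset.sum_le_sum fun i _ => hpos i
  · push Not at hpos
    obtain ⟨i, hi⟩ := hpos
    have h0 : ∑ j : Fin t, d (Fin.natAdd h j) = 0 := by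
      refine Finset.sum_eq_zero fun j _ => ?_
      have : d (Fin.natAdd h j) ≤ d (Fin.castLE hn i) := hd (by
        rw [Fin.le_def]
        simp only [Fin.val_castLE, Fin.val_natAdd]
        omega)
      omega
    rw [h0] at hsum
    exact hsum

/-- A split graph with `n / 2 ≤ ∑ i, d i` decomposes into two locally irregular subgraphs, unless
it is a path with four vertices. -/
theorem IsSplit.exists_decomposition_two_of_le_sum {V : Type*} [Finite V]
    {G : SimpleGraph V} {X Y : Set V} (hG : G.IsSplit X Y) {n : ℕ} (hn2 : 2 ≤ n) (hn9 : n ≤ 9)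
    {v : Fin n → V} (hv : Function.Injective v)
    (hX : Set.range v = X) {d : Fin n → ℕ} (hd : ∀ i, d i = G.degreeInto (v i) Y)
    (hanti : Antitone d) (hsum : n / 2 ≤ ∑ i, d i) (hP : n ≠ 2 ∨ ∀ i, d i ≠ 1) :
    ∃ l ≤ 2, G.HasLocallyIrregularDecomposition l := by
  have hh : n / 2 ≤ n := Nat.div_le_self _ _
  have hanti' : ∀ i j : Fin n, i.1 ≤ j.1 → d j ≤ d i := fun i j hij => hanti hij
  have reorder : ∀ τ : Fin n → Fin n, Function.Injective τ → Set.range (v ∘ τ) = X := by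
    intro τ hτ
    rw [(Finite.surjective_of_injective hτ).range_comp, hX]
  let last : Fin n := ⟨n - 1, by omega⟩
  -- The standard arrangement puts the last vertex at position `n / 2`. It fails only if that vertex
  -- has a single outer neighbour and this neighbour sees the whole second block.
  by_cases hA : d last = 1 → ∀ y ∈ Y, G.Adj (v last) y →
      ∃ j : Fin n, n / 2 ≤ j.1 ∧ ¬ G.Adj (v j) y
  · obtain ⟨σ, hσ, hinj, hpos⟩ := exists_arrangement (h := n / 2) (by omega) (by omega)
      (fun i => d (Fin.castLE hh i)) (fun i j hij => hanti hij) (le_sum_castLE hh hanti hsum)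
    let τ : Fin n → Fin n := fun i => if hi : i.1 < n / 2 then Fin.castLE hh (σ ⟨i, hi⟩)
      else ⟨n - 1 - (i - n / 2), by omega⟩
    have hτ1 : ∀ (i : Fin n) (hi : i.1 < n / 2), τ i = Fin.castLE hh (σ ⟨i, hi⟩) :=
      fun i hi => dif_pos hi
    have hτ2 : ∀ (i : Fin n), n / 2 ≤ i.1 → (τ i).1 = n - 1 - (i - n / 2) := by
      intro i hi
      simp only [τ]
      rw [dif_neg (by omega)]
    have hτ3 : ∀ (i : Fin n), i.1 < n / 2 → (τ i).1 < n / 2 := by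
      intro i hi
      rw [hτ1 i hi]
      exact (σ ⟨i, hi⟩).2
    have hτ : Function.Injective τ := by
      intro i j hij
      have hij' : (τ i).1 = (τ j).1 := by rw [hij]
      have hi2 := i.2
      have hj2 := j.2
      by_cases hi : i.1 < n / 2 <;> by_cases hj : j.1 < n / 2
      · rw [hτ1 i hi, hτ1 j hj] at hij
        have := hσ (Fin.castLE_injective hh hij)
        exact Fin.ext (by simpa using this)
      · have h1 := hτ3 i hi
        rw [hτ2 j (by omega)] at hij'
        omega
      · have h1 := hτ3 j hj
        rw [hτ2 i (by omega)] at hij'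
        omega
      · rw [hτ2 i (by omega), hτ2 j (by omega)] at hij'
        exact Fin.ext (by omega)
    refine hG.exists_decomposition_two_of_threshold hn2 hn9 (hv.comp hτ) (reorder τ hτ)
      (d := d ∘ τ) (fun i => hd _) ?_ ?_ ?_ ?_
    · intro i j hi hj hij h
      simp only [Function.comp, hτ1 i hi, hτ1 j hj] at h
      have := @hinj ⟨i, hi⟩ ⟨j, hj⟩ h
      exact hij (Fin.ext (by simpa using this))
    · intro i hi
      have := hpos ⟨i, hi⟩
      simpa only [Function.comp, hτ1 i hi] using this
    · intro i j hi hij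
      have hij' : i.1 < j.1 := hij
      refine hanti' _ _ ?_
      rw [hτ2 i hi, hτ2 j (by omega)]
      omega
    · intro i hi h1 y hy hadj
      have hil : τ i = last := Fin.ext (by rw [hτ2 i hi.ge]; simp only [last]; omega)
      simp only [Function.comp, hil] at h1 hadj
      obtain ⟨j, hj, hjy⟩ := hA h1 y hy hadj
      have hj2 := j.2
      refine ⟨⟨n - 1 - (j.1 - n / 2), by omega⟩, by simp only; omega, ?_⟩
      have : τ ⟨n - 1 - (j.1 - n / 2), by omega⟩ = j :=
        Fin.ext (by rw [hτ2 _ (by simp only; omega)]; simp only; omega)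
      simpa only [Function.comp, this] using hjy
  · push Not at hA
    obtain ⟨hlast, y₀, hy₀, hadj₀, hall⟩ := hA
    obtain ⟨w, hw⟩ := hG.exists_not_adj hX hy₀
    have hwh : w.1 < n / 2 := by
      by_contra h
      exact hw (hall w (by omega))
    -- For `n = 2` the positions `n / 2` and `n - 1` coincide, so the arrangement below is not
    -- available.
    have hn3 : 3 ≤ n := by
      rcases hP with h | h
      · omega
      · exact absurd hlast (h last)
    have hge : ∀ i, 1 ≤ d i := fun i => by
      rw [← hlast]
      exact hanti' _ _ (by simp only [last]; omega)
    -- With `h = n / 2`, the first block takes the indices `{0, …, h}` without `w` in decreasing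
    -- order, then come `n - 1, …, h + 1`, and the final position takes `w`. Thus `y₀` misses a
    -- vertex of the second block. Since every `d` is positive and `d` grows with the position in
    -- the first block, `i + d` is strictly increasing and positive there.
    let τ : Fin n → Fin n := fun i => ⟨if i.1 < n / 2 then
      (if i.1 < n / 2 - w.1 then n / 2 - i.1 else n / 2 - 1 - i.1) else
      if i.1 < n - 1 then n - 1 - (i.1 - n / 2) else w.1, by split_ifs <;> omega⟩
    have hτv : ∀ i, (τ i).1 = if i.1 < n / 2 then
      (if i.1 < n / 2 - w.1 then n / 2 - i.1 else n / 2 - 1 - i.1) else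
      if i.1 < n - 1 then n - 1 - (i.1 - n / 2) else w.1 := fun i => rfl
    have hτ : Function.Injective τ := by
      intro i j hij
      have hij' : (τ i).1 = (τ j).1 := by rw [hij]
      rw [hτv, hτv] at hij'
      have hi2 := i.2
      have hj2 := j.2
      refine Fin.ext ?_
      split_ifs at hij' <;> omega
    refine hG.exists_decomposition_two_of_threshold hn2 hn9 (hv.comp hτ) (reorder τ hτ)
      (d := d ∘ τ) (fun i => hd _) ?_ ?_ ?_ ?_
    · have key : ∀ i j : Fin n, i.1 < n / 2 → j.1 < n / 2 → i < j →
          i + d (τ i) < j + d (τ j) := by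
        intro i j hi hj hij
        have hij' : i.1 < j.1 := hij
        have : d (τ i) ≤ d (τ j) := hanti' _ _ (by
          rw [hτv, hτv]
          split_ifs <;> omega)
        omega
      intro i j hi hj hij
      rcases lt_or_gt_of_ne hij with h | h
      · exact (key i j hi hj h).ne
      · exact (key j i hj hi h).ne'
    · intro i hi
      have := hge (τ i)
      simp only [Function.comp]
      omega
    · intro i j hi hij
      have hij' : i.1 < j.1 := hij
      have hj2 := j.2
      refine hanti' _ _ ?_
      rw [hτv, hτv]
      split_ifs <;> omega
    · intro i hi h1 y hy hadj
      have hil : τ i = last := Fin.ext (by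
        rw [hτv]
        simp only [last]
        split_ifs <;> omega)
      simp only [Function.comp, hil] at h1 hadj
      have hyy : y = y₀ := by
        rw [hd, degreeInto, Set.ncard_eq_one] at h1
        obtain ⟨z, hz⟩ := h1
        have e1 : y ∈ G.neighborSet (v last) ∩ Y := ⟨hadj, hy⟩
        have e2 : y₀ ∈ G.neighborSet (v last) ∩ Y := ⟨hadj₀, hy₀⟩
        rw [hz, Set.mem_singleton_iff] at e1 e2
        rw [e1, e2]
      subst hyy
      refine ⟨last, by simp only [last]; omega, ?_⟩
      have : τ last = w := Fin.ext (by
        rw [hτv]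
        simp only [last]
        split_ifs <;> omega)
      simpa only [Function.comp, this] using hw

end LargeSum

/-! ### Explicit colourings for small sums. -/

section SmallSum

/-- The threshold colouring with the colours of the pairs in `flips` exchanged. -/
def flippedColour (flips : List (ℕ × ℕ)) (h a b : ℕ) : Fin 2 :=
  if (min a b, max a b) ∈ flips then 1 - thresholdColour h a b else thresholdColour h a b

theorem flippedColour_comm (flips : List (ℕ × ℕ)) (h a b : ℕ) :
    flippedColour flips h a b = flippedColour flips h b a := by
  rw [flippedColour, flippedColour, min_comm, max_comm, thresholdColour_comm]

/-- The numerical conditions of `IsSplit.exists_decomposition_of_colourDegree`. -/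
def IsIrregularColouring {n k : ℕ} (d : Fin n → ℕ) (c : Fin n → Fin n → Fin k)
    (e : Fin n → Fin k) : Prop :=
  (∀ i j, i ≠ j → colourDegree c e d (c i j) i ≠ colourDegree c e d (c i j) j) ∧
  ∀ i, 1 ≤ d i →
    (Finset.univ.filter fun j => e j = e i ∧ 1 ≤ d j).card < colourDegree c e d (e i) i

instance {n k : ℕ} (d : Fin n → ℕ) (c : Fin n → Fin n → Fin k) (e : Fin n → Fin k) :
    Decidable (IsIrregularColouring d c e) := by
  unfold IsIrregularColouring
  infer_instance

/-- In this and the next four colourings the sum is below `n / 2 = 4`, so no arrangement of the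
threshold colouring works and some pairs are flipped. The vector inside `flippedColour`, if any,
gives the positions of the clique vertices; the last argument gives the colours of the outer edges.
-/
theorem isIrregularColouring_eight_one_one_one :
    IsIrregularColouring ![1, 1, 1, 0, 0, 0, 0, 0]
      (fun i j => flippedColour [(0, 1), (0, 6)] 4 (![0, 4, 5, 1, 2, 3, 6, 7] i)
        (![0, 4, 5, 1, 2, 3, 6, 7] j)) ![1, 0, 1, 0, 0, 0, 0, 0] := by
  decide +kernel

theorem isIrregularColouring_nine_one_one_one :
    IsIrregularColouring ![1, 1, 1, 0, 0, 0, 0, 0, 0]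
      (fun i j => flippedColour [(0, 1), (0, 6)] 4 (![0, 4, 5, 1, 2, 3, 6, 7, 8] i)
        (![0, 4, 5, 1, 2, 3, 6, 7, 8] j)) ![1, 0, 1, 0, 0, 0, 0, 0, 0] := by
  decide +kernel

/-- After the flip, positions `1` and `2` both have degree `5` in colour `0`, but their edge now has
colour `1`, where their degrees differ. -/
theorem isIrregularColouring_eight_two_one :
    IsIrregularColouring ![2, 1, 0, 0, 0, 0, 0, 0]
      (fun i j => flippedColour [(1, 2)] 4 i j) (fun _ => 0) := by
  decide +kernel

theorem isIrregularColouring_nine_two_one :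
    IsIrregularColouring ![2, 1, 0, 0, 0, 0, 0, 0, 0]
      (fun i j => flippedColour [(1, 2)] 4 i j) (fun _ => 0) := by
  decide +kernel

theorem isIrregularColouring_nine_one_one :
    IsIrregularColouring ![1, 1, 0, 0, 0, 0, 0, 0, 0]
      (fun i j => flippedColour [(1, 8), (2, 4), (2, 6), (2, 8), (4, 7), (5, 7)] 4
        (![4, 5, 0, 1, 2, 3, 6, 7, 8] i) (![4, 5, 0, 1, 2, 3, 6, 7, 8] j))
      ![0, 1, 0, 0, 0, 0, 0, 0, 0] := by
  decide +kernel

/-- The threshold colouring, except that the pairs `{0, 1}` and `{0, h}` get a third colour; the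
positions `0, …, h - 1` are reversed. -/
def threeColour (h i j : ℕ) : Fin 3 :=
  let a := if i < h then h - 1 - i else i
  let b := if j < h then h - 1 - j else j
  if min a b = 0 ∧ (max a b = 1 ∨ max a b = h) then 2 else (thresholdColour h a b).castSucc

theorem threeColour_comm (h i j : ℕ) : threeColour h i j = threeColour h j i := by
  simp only [threeColour]
  rw [min_comm, max_comm, thresholdColour_comm]

/-- With `h = n / 2`, removing the path with centre `0` and ends `1` and `h` leaves these positions
with clique degrees `h - 2`, `h` and `h - 1` in colour `0`, and the remaining ties are not adjacent
there. The reversal puts the vertices with outer neighbours at the positions of largest degree,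
where outer edges create no new tie. -/
theorem isIrregularColouring_three_single : ∀ n < 10, 4 ≤ n → ∀ k < n / 2,
    IsIrregularColouring (fun i : Fin n => if i.1 = 0 then k else 0)
      (fun i j => threeColour (n / 2) i j) (fun _ => 0) := by
  decide +kernel

theorem isIrregularColouring_three_pair : ∀ n < 9, 6 ≤ n →
    IsIrregularColouring (fun i : Fin n => if i.1 < 2 then 1 else 0)
      (fun i j => threeColour (n / 2) i j) (fun _ => 0) := by
  decide +kernel

end SmallSum

/-! ### An Erdős–Gallai inequality. -/

section DegreeSums

/-- The Erdős–Gallai inequality for the row sums of the adjacency matrix of a graph. -/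
theorem sum_rowSum_le {m : ℕ} {M : Fin m → Fin m → ℕ} (hsymm : ∀ i j, M i j = M j i)
    (hle : ∀ i j, M i j ≤ 1) (hdiag : ∀ i, M i i = 0) {A B : Finset (Fin m)}
    (hAB : Disjoint A B) :
    ∑ i ∈ A, ∑ j, M i j ≤
      ∑ i ∈ B, ∑ j, M i j + A.card * (A.card - 1) + A.card * (m - A.card - B.card) := by
  have hsplit : ∀ i, ∑ j, M i j =
      ∑ j ∈ A, M i j + ∑ j ∈ B, M i j + ∑ j ∈ (A ∪ B)ᶜ, M i j := by
    intro i
    rw [← Finset.sum_union hAB, Finset.sum_add_sum_compl]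
  have h1 : ∑ i ∈ A, ∑ j ∈ A, M i j ≤ A.card * (A.card - 1) := by
    rw [← smul_eq_mul]
    refine Finset.sum_le_card_nsmul _ _ _ fun i hi => ?_
    rw [← Finset.add_sum_erase _ _ hi, hdiag, zero_add, ← Finset.card_erase_of_mem hi]
    simpa using Finset.sum_le_card_nsmul (A.erase i) (M i) 1 fun j _ => hle i j
  -- By symmetry the entries in `A × B` are charged to the rows of `B`.
  have h2 : ∑ i ∈ A, ∑ j ∈ B, M i j ≤ ∑ i ∈ B, ∑ j, M i j := by
    rw [Finset.sum_comm]
    refine Finset.sum_le_sum fun j _ => ?_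
    simp only [hsymm _ j]
    exact Finset.sum_le_sum_of_subset (Finset.subset_univ _)
  have h3 : ∑ i ∈ A, ∑ j ∈ (A ∪ B)ᶜ, M i j ≤ A.card * (m - A.card - B.card) := by
    rw [← smul_eq_mul]
    refine Finset.sum_le_card_nsmul _ _ _ fun i hi => ?_
    have h4 : (A ∪ B)ᶜ.card = m - A.card - B.card := by
      rw [Finset.card_compl, Finset.card_union_of_disjoint hAB, Fintype.card_fin]
      omega
    rw [← h4]
    simpa using Finset.sum_le_card_nsmul (A ∪ B)ᶜ (M i) 1 fun j _ => hle i j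
  calc ∑ i ∈ A, ∑ j, M i j
      = ∑ i ∈ A, ∑ j ∈ A, M i j + ∑ i ∈ A, ∑ j ∈ B, M i j + ∑ i ∈ A, ∑ j ∈ (A ∪ B)ᶜ, M i j := by
        simp only [hsplit, Finset.sum_add_distrib]
    _ ≤ _ := by omega

end DegreeSums

/-! ### Finite enumeration of degrees and adjacencies. -/

section Enumeration

/-- All lists of length `m` with entries `0` and `1`. -/
def binaryLists : ℕ → List (List ℕ)
  | 0 => [[]]
  | m + 1 => (binaryLists m).map (0 :: ·) ++ (binaryLists m).map (1 :: ·)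

theorem ofFn_mem_binaryLists : ∀ {m : ℕ} (α : Fin m → ℕ), (∀ i, α i ≤ 1) →
    List.ofFn α ∈ binaryLists m
  | 0, α, _ => by simp [binaryLists]
  | m + 1, α, h => by
    have ih := ofFn_mem_binaryLists (fun i : Fin m => α i.succ) fun i => h _
    rw [List.ofFn_succ, binaryLists, List.mem_append]
    have h0 := h 0
    obtain h1 | h1 : α 0 = 0 ∨ α 0 = 1 := by omega
    · exact Or.inl (List.mem_map.2 ⟨_, ih, by rw [h1]⟩)
    · exact Or.inr (List.mem_map.2 ⟨_, ih, by rw [h1]⟩)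

/-- All strictly increasing lists of length `m` with entries in `[a, a + f)`. -/
def increasingLists : ℕ → ℕ → ℕ → List (List ℕ)
  | 0, m, _ => if m = 0 then [[]] else []
  | _ + 1, 0, _ => [[]]
  | f + 1, m + 1, a =>
    (increasingLists f m (a + 1)).map (a :: ·) ++ increasingLists f (m + 1) (a + 1)

theorem ofFn_mem_increasingLists : ∀ {f m a : ℕ} (t : Fin m → ℕ), StrictMono t →
    (∀ i, a ≤ t i) → (∀ i, t i < a + f) → List.ofFn t ∈ increasingLists f m a
  | 0, 0, a, t, _, _, _ => by simp [increasingLists]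
  | 0, m + 1, a, t, _, h1, h2 => by
    have := h1 0
    have := h2 0
    omega
  | f + 1, 0, a, t, _, _, _ => by simp [increasingLists]
  | f + 1, m + 1, a, t, ht, h1, h2 => by
    rw [increasingLists, List.mem_append]
    by_cases h0 : t 0 = a
    · left
      rw [List.ofFn_succ, List.mem_map]
      refine ⟨_, ofFn_mem_increasingLists (fun i => t i.succ) ?_ ?_ ?_, by rw [h0]⟩
      · exact fun i j hij => ht (Fin.succ_lt_succ_iff.2 hij)
      · intro i
        have := ht (Fin.succ_pos i)
        omega
      · intro i
        have := h2 i.succ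
        omega
    · right
      refine ofFn_mem_increasingLists t ht ?_ ?_
      · intro i
        have h3 := ht.monotone (Fin.zero_le i)
        have h4 := h1 0
        omega
      · intro i
        have := h2 i
        omega

/-- The sum of the last `k` entries of a list. -/
def topSum (k : ℕ) (l : List ℕ) : ℕ := (l.drop (l.length - k)).sum

/-- The Erdős–Gallai inequality for the `k` largest and the `l` smallest entries of `t`, where `t`
lists the degrees of the vertices of a set `U` in increasing order, and `α` and `γ` list the
adjacencies of the vertices of `U` to two vertices outside `U`. -/
def degreeInequality (t α γ : List ℕ) (p : ℕ × ℕ) : Bool :=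
  Nat.ble (topSum p.1 t + (α.take p.2).sum + (γ.take p.2).sum)
    ((t.take p.2).sum + topSum p.1 α + topSum p.1 γ + p.1 * (p.1 - 1) +
      p.1 * (t.length - p.1 - p.2))

/-- The degrees inside `U` are `t - α - γ`; the subtracted sums are moved across to avoid truncated
subtraction. The rest is `sum_rowSum_le` for the last `k` and the first `l` indices. -/
theorem degreeInequality_ofFn {m : ℕ} {M : Fin m → Fin m → ℕ} (hsymm : ∀ i j, M i j = M j i)
    (hle : ∀ i j, M i j ≤ 1) (hdiag : ∀ i, M i i = 0) {t α γ : Fin m → ℕ}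
    (ht : ∀ i, t i = ∑ j, M i j + α i + γ i) {p : ℕ × ℕ} (hp : p.1 + p.2 ≤ m) :
    degreeInequality (List.ofFn t) (List.ofFn α) (List.ofFn γ) p = true := by
  obtain ⟨k, l⟩ := p
  simp only at hp
  have htake : ∀ (f : Fin m → ℕ) (i : ℕ),
      ((List.ofFn f).take i).sum = ∑ j : Fin m with j.1 < i, f j := fun f i =>
    List.sum_take_ofFn f i
  have htop : ∀ f : Fin m → ℕ, topSum k (List.ofFn f) = ∑ j : Fin m with ¬ j.1 < m - k, f j := by
    intro f
    have h1 := List.sum_take_add_sum_drop (List.ofFn f) (m - k)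
    rw [htake, List.sum_ofFn, 
      ← Finset.sum_filter_add_sum_filter_not Finset.univ (fun j => j.1 < m - k)] at h1
    rw [topSum, List.length_ofFn]
    omega
  have hA : (Finset.univ.filter fun j : Fin m => ¬ j.1 < m - k).card = k := by
    have h2 := Finset.card_filter_add_card_filter_not (s := (Finset.univ : Finset (Fin m)))
      (fun j => j.1 < m - k)
    rw [Fin.card_filter_val_lt, Finset.card_univ, Fintype.card_fin] at h2
    omega
  have hB : (Finset.univ.filter fun j : Fin m => j.1 < l).card = l := by
    rw [Fin.card_filter_val_lt]
    omega
  have hdisj : Disjoint (Finset.univ.filter fun j : Fin m => ¬ j.1 < m - k)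
      (Finset.univ.filter fun j : Fin m => j.1 < l) := by
    rw [Finset.disjoint_left]
    intro j hj hj'
    simp only [Finset.mem_filter, Finset.mem_univ, true_and] at hj hj'
    omega
  have key := sum_rowSum_le hsymm hle hdiag hdisj
  rw [hA, hB] at key
  rw [degreeInequality, Nat.ble_eq]
  simp only [htake, htop, List.length_ofFn, ht, Finset.sum_add_distrib]
  omega

/-- The list `t` of degrees and the list `α` of adjacencies to a vertex `v` are compatible with
`v` having degree `ρ` and `d` neighbours outside the clique. -/
def avoidsDegree (ρ d : ℕ) : List ℕ → List ℕ → Bool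
  | a :: t, b :: α =>
    (if b == 0 then !(a + d == ρ) else !(a == ρ)) && avoidsDegree ρ d t α
  | _, _ => true

theorem avoidsDegree_ofFn {ρ d : ℕ} : ∀ {m : ℕ} {t α : Fin m → ℕ},
    (∀ i, α i = 1 → t i ≠ ρ) → (∀ i, α i = 0 → t i + d ≠ ρ) → (∀ i, α i ≤ 1) →
    avoidsDegree ρ d (List.ofFn t) (List.ofFn α) = true
  | 0, t, α, _, _, _ => by simp [avoidsDegree]
  | m + 1, t, α, h1, h2, h3 => by
    rw [List.ofFn_succ, List.ofFn_succ, avoidsDegree, Bool.and_eq_true]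
    refine ⟨?_, avoidsDegree_ofFn (fun i => h1 i.succ) (fun i => h2 i.succ) fun i => h3 i.succ⟩
    have a1 := h1 0
    have a2 := h2 0
    have a3 := h3 0
    obtain h | h : α 0 = 0 ∨ α 0 = 1 := by omega
    · have := a2 h
      simp [h, this]
    · have := a1 h
      simp [h, this]

/-- No degrees and adjacencies are feasible for a clique on `n` vertices one of which has fewer
than `n / 2` neighbours outside. -/
def singleInfeasible (n : ℕ) (ps : List (ℕ × ℕ)) : Bool :=
  (increasingLists n (n - 1) 0).all fun t => (binaryLists (n - 1)).all fun α =>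
    !(ps.all (degreeInequality t α [])) ||
      (List.range (n / 2)).all fun k => (List.range (k + 1)).all fun x =>
        !avoidsDegree (α.sum + x) k t α

/-- The possible degrees and adjacencies of a vertex with one neighbour outside the clique. -/
def pairCandidates (m e : ℕ) (t : List ℕ) : List (ℕ × List ℕ) :=
  ((binaryLists m).map (fun α => (α.sum + e, α)) ++
    (binaryLists m).map fun α => (α.sum + e + 1, α)).filter fun q => avoidsDegree q.1 1 t q.2

/-- No degrees and adjacencies are feasible for a clique on `m + 2` vertices two of which have one
neighbour outside. -/
def pairInfeasible (m : ℕ) (ps : List (ℕ × ℕ)) : Bool :=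
  (increasingLists (m + 2) m 0).all fun t => [0, 1].all fun e =>
    (pairCandidates m e t).all fun q => (pairCandidates m e t).all fun r =>
      q.1 == r.1 || !(ps.all (degreeInequality t q.2 r.2))

end Enumeration

/-! ### The finite checks and their soundness. -/

section Infeasible

/-- In every pair used here and below, the top and bottom blocks exhaust `U`, so the last term of
the Erdős–Gallai inequality vanishes. -/
theorem singleInfeasible_of_le : ∀ n < 10, 4 ≤ n →
    singleInfeasible n [((n - 1) / 2, n - 1 - (n - 1) / 2), (n - 1 - (n - 1) / 2, (n - 1) / 2)] =
      true := by
  decide +kernel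

theorem pairInfeasible_four : pairInfeasible 4 [(1, 3), (2, 2), (3, 1)] = true := by
  decide +kernel

theorem pairInfeasible_five : pairInfeasible 5 [(2, 3), (3, 2)] = true := by
  decide +kernel

theorem pairInfeasible_six : pairInfeasible 6 [(2, 4), (3, 3), (4, 2)] = true := by
  decide +kernel

/-- Injective degrees can be sorted by a permutation of the vertices. -/
theorem exists_perm_strictMono {m : ℕ} {t : Fin m → ℕ} (ht : Function.Injective t) :
    ∃ σ : Equiv.Perm (Fin m), StrictMono (t ∘ σ) :=
  ⟨Tuple.sort t, (Tuple.monotone_sort t).strictMono_of_injective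
    (ht.comp (Tuple.sort t).injective)⟩

theorem rowSum_le {m : ℕ} {M : Fin m → Fin m → ℕ} (hle : ∀ i j, M i j ≤ 1)
    (hdiag : ∀ i, M i i = 0) (i : Fin m) : ∑ j, M i j ≤ m - 1 := by
  rw [← Finset.add_sum_erase _ _ (Finset.mem_univ i), hdiag, zero_add]
  have := Finset.sum_le_card_nsmul (Finset.univ.erase i) (M i) 1 fun j _ => hle i j
  rwa [Finset.card_erase_of_mem (Finset.mem_univ i), Finset.card_univ, Fintype.card_fin,
    smul_eq_mul, mul_one] at this

/-- For the special vertex, `α` is its adjacency row, `ρ` its degree in the first colour, `k` its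
number of outer neighbours and `x` the number of those in the first colour. Sorting `t` relabels `M`
and `α` by the same permutation, so only increasing lists need to be checked. -/
theorem singleInfeasible_sound {m : ℕ} {ps : List (ℕ × ℕ)} (hps : ∀ p ∈ ps, p.1 + p.2 ≤ m)
    (hcheck : singleInfeasible (m + 1) ps = true) {M : Fin m → Fin m → ℕ}
    (hsymm : ∀ i j, M i j = M j i) (hle : ∀ i j, M i j ≤ 1) (hdiag : ∀ i, M i i = 0)
    {α t : Fin m → ℕ} (hα : ∀ i, α i ≤ 1) (ht : ∀ i, t i = ∑ j, M i j + α i)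
    (hinj : Function.Injective t) {k x ρ : ℕ} (hk : k < (m + 1) / 2) (hx : x ≤ k)
    (hρ : ρ = ∑ i, α i + x) (h1 : ∀ i, α i = 1 → t i ≠ ρ) (h0 : ∀ i, α i = 0 → t i + k ≠ ρ) :
    False := by
  obtain ⟨σ, hσ⟩ := exists_perm_strictMono hinj
  -- A degree is at most `(m - 1) + 1`, so the `m` distinct degrees omit just one value of `[0, m +
  -- 1)`.
  have hmem : List.ofFn (t ∘ σ) ∈ increasingLists (m + 1) m 0 := by
    refine ofFn_mem_increasingLists _ hσ (fun _ => Nat.zero_le _) fun i => ?_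
    have a1 := rowSum_le hle hdiag (σ i)
    have a2 := hα (σ i)
    have a3 := (σ i).pos
    simp only [Function.comp, ht]
    omega
  have hineq : ∀ p ∈ ps,
      degreeInequality (List.ofFn (t ∘ σ)) (List.ofFn (α ∘ σ)) [] p = true := by
    intro p hp
    have := degreeInequality_ofFn (M := fun i j => M (σ i) (σ j)) (fun i j => hsymm _ _)
      (fun i j => hle _ _) (fun i => hdiag _) (t := t ∘ σ) (α := α ∘ σ) (γ := fun _ => 0)
      (fun i => by
        simp only [Function.comp, ht, add_zero]
        rw [Equiv.sum_comp σ (M (σ i))]) (hps p hp)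
    simpa [degreeInequality, topSum, List.ofFn_const] using this
  have hav := avoidsDegree_ofFn (ρ := ρ) (d := k) (t := t ∘ σ) (α := α ∘ σ)
    (fun i => h1 _) (fun i => h0 _) fun i => hα _
  have hsum : (List.ofFn (α ∘ σ)).sum = ∑ i, α i := by
    rw [List.sum_ofFn]
    exact Equiv.sum_comp σ α
  rw [singleInfeasible, List.all_eq_true] at hcheck
  have c1 := hcheck _ hmem
  rw [List.all_eq_true] at c1
  have c2 := c1 _ (ofFn_mem_binaryLists (α ∘ σ) fun i => hα _)
  rw [List.all_eq_true.2 hineq, Bool.not_true, Bool.false_or, List.all_eq_true] at c2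
  have c3 := c2 k (List.mem_range.2 hk)
  rw [List.all_eq_true] at c3
  have c4 := c3 x (List.mem_range.2 (by omega))
  rw [hsum, ← hρ, hav] at c4
  exact absurd c4 (by decide)

theorem mem_pairCandidates {m e x ρ : ℕ} {t α : Fin m → ℕ} (hα : ∀ i, α i ≤ 1) (hx : x ≤ 1)
    (hρ : ρ = ∑ i, α i + e + x) (h1 : ∀ i, α i = 1 → t i ≠ ρ) (h0 : ∀ i, α i = 0 → t i + 1 ≠ ρ) :
    (ρ, List.ofFn α) ∈ pairCandidates m e (List.ofFn t) := by
  have hmem := ofFn_mem_binaryLists α hα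
  rw [pairCandidates, List.mem_filter, List.mem_append, List.mem_map, List.mem_map]
  refine ⟨?_, avoidsDegree_ofFn h1 h0 hα⟩
  obtain rfl | rfl : x = 0 ∨ x = 1 := by omega
  · exact Or.inl ⟨_, hmem, by rw [List.sum_ofFn, hρ, add_zero]⟩
  · exact Or.inr ⟨_, hmem, by rw [List.sum_ofFn, hρ]⟩

theorem pairInfeasible_sound {m : ℕ} {ps : List (ℕ × ℕ)} (hps : ∀ p ∈ ps, p.1 + p.2 ≤ m)
    (hcheck : pairInfeasible m ps = true) {M : Fin m → Fin m → ℕ}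
    (hsymm : ∀ i j, M i j = M j i) (hle : ∀ i j, M i j ≤ 1) (hdiag : ∀ i, M i i = 0)
    {α γ t : Fin m → ℕ} (hα : ∀ i, α i ≤ 1) (hγ : ∀ i, γ i ≤ 1)
    (ht : ∀ i, t i = ∑ j, M i j + α i + γ i)
    (hinj : Function.Injective t) {e x y ρ τ : ℕ} (he : e ≤ 1) (hx : x ≤ 1) (hy : y ≤ 1)
    (hρ : ρ = ∑ i, α i + e + x) (hτ : τ = ∑ i, γ i + e + y) (hne : ρ ≠ τ)
    (h1 : ∀ i, α i = 1 → t i ≠ ρ) (h0 : ∀ i, α i = 0 → t i + 1 ≠ ρ)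
    (h1' : ∀ i, γ i = 1 → t i ≠ τ) (h0' : ∀ i, γ i = 0 → t i + 1 ≠ τ) :
    False := by
  obtain ⟨σ, hσ⟩ := exists_perm_strictMono hinj
  -- Here a degree is at most `(m - 1) + 2`, because of the two special vertices.
  have hmem : List.ofFn (t ∘ σ) ∈ increasingLists (m + 2) m 0 := by
    refine ofFn_mem_increasingLists _ hσ (fun _ => Nat.zero_le _) fun i => ?_
    have a1 := rowSum_le hle hdiag (σ i)
    have a2 := hα (σ i)
    have a4 := hγ (σ i)
    have a3 := (σ i).pos
    simp only [Function.comp, ht]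
    omega
  have hineq : ∀ p ∈ ps, degreeInequality (List.ofFn (t ∘ σ)) (List.ofFn (α ∘ σ))
      (List.ofFn (γ ∘ σ)) p = true := by
    intro p hp
    refine degreeInequality_ofFn (M := fun i j => M (σ i) (σ j)) (fun i j => hsymm _ _)
      (fun i j => hle _ _) (fun i => hdiag _) (fun i => ?_) (hps p hp)
    simp only [Function.comp, ht]
    rw [Equiv.sum_comp σ (M (σ i))]
  have hm1 := mem_pairCandidates (t := t ∘ σ) (α := α ∘ σ) (e := e) (x := x) (ρ := ρ)
    (fun i => hα _) hx (by rw [hρ]; simp only [Function.comp]; rw [Equiv.sum_comp σ α])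
    (fun i => h1 _) (fun i => h0 _)
  have hm2 := mem_pairCandidates (t := t ∘ σ) (α := γ ∘ σ) (e := e) (x := y) (ρ := τ)
    (fun i => hγ _) hy (by rw [hτ]; simp only [Function.comp]; rw [Equiv.sum_comp σ γ])
    (fun i => h1' _) (fun i => h0' _)
  rw [pairInfeasible, List.all_eq_true] at hcheck
  have c1 := hcheck _ hmem
  rw [List.all_eq_true] at c1
  have c2 := c1 e (by simp; omega)
  rw [List.all_eq_true] at c2
  have c3 := c2 _ hm1
  rw [List.all_eq_true] at c3
  have c4 := c3 _ hm2
  simp only [List.all_eq_true.2 hineq, Bool.not_true, Bool.or_false, beq_iff_eq] at c4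
  exact hne c4

end Infeasible

/-! ### Two colours do not suffice in the remaining cases. -/

section LowerBound

/-- The numerical data of a decomposition of a split graph into two locally irregular subgraphs:
the adjacency matrix `M` of the first subgraph on the clique, and the numbers `x i` of neighbours
of `v i` outside the clique in the first subgraph. -/
theorem IsSplit.exists_matrix {V : Type*} [Finite V] {G : SimpleGraph V} {X Y : Set V}
    (hG : G.IsSplit X Y) {n : ℕ} {v : Fin n → V} (hv : Function.Injective v)
    (hX : Set.range v = X) {d : Fin n → ℕ} (hd : ∀ i, d i = G.degreeInto (v i) Y)
    (h : G.HasLocallyIrregularDecomposition 2) :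
    ∃ (M : Fin n → Fin n → ℕ) (x ρ : Fin n → ℕ), (∀ i j, M i j = M j i) ∧ (∀ i j, M i j ≤ 1) ∧
      (∀ i, M i i = 0) ∧ (∀ i, x i ≤ d i) ∧ (∀ i, ρ i = ∑ j, M i j + x i) ∧
      (∀ i j, M i j = 1 → ρ i ≠ ρ j) ∧
      ∀ i j, i ≠ j → M i j = 0 → ρ i + d j ≠ ρ j + d i := by
  classical
  obtain ⟨H, hH, hirr⟩ := h
  have hor : ∀ {a b}, G.Adj a b → (H 0).Adj a b ∨ (H 1).Adj a b := by
    intro a b hab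
    obtain ⟨i, hi⟩ := hH.exists_adj hab
    match i, hi with
    | 0, hi => exact Or.inl hi
    | 1, hi => exact Or.inr hi
  have hsum : ∀ i, ((H 0).neighborSet (v i)).ncard + ((H 1).neighborSet (v i)).ncard =
      n - 1 + d i := by
    intro i
    rw [← hG.ncard_neighborSet hv hX hd i, ← Set.ncard_union_eq ?_ (Set.toFinite _)
      (Set.toFinite _)]
    · congr 1
      ext w
      exact ⟨fun h => h.elim (fun h => h.adj_sub) fun h => h.adj_sub, fun h => hor h⟩
    · rw [Set.disjoint_left]
      intro w h0 h1
      exact absurd (hH.eq_of_adj h0 h1) (by decide)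
  refine ⟨fun i j => if (H 0).Adj (v i) (v j) then 1 else 0,
    fun i => ((H 0).neighborSet (v i) ∩ Y).ncard, fun i => ((H 0).neighborSet (v i)).ncard,
    ?_, ?_, ?_, ?_, ?_, ?_, ?_⟩
  · intro i j
    simp only [Subgraph.adj_comm]
  · intro i j
    dsimp only
    split_ifs <;> omega
  · intro i
    exact if_neg fun h => h.ne rfl
  · intro i
    rw [hd]
    exact Set.ncard_le_ncard (fun w hw => ⟨hw.1.adj_sub, hw.2⟩) (Set.toFinite _)
  · intro i
    have hsplit : (H 0).neighborSet (v i) =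
        v '' {j | (H 0).Adj (v i) (v j)} ∪ ((H 0).neighborSet (v i) ∩ Y) := by
      ext w
      constructor
      · intro hw
        obtain ⟨j, rfl⟩ | hw' := hG.exists_or_mem hX w
        · exact Or.inl ⟨j, hw, rfl⟩
        · exact Or.inr ⟨hw, hw'⟩
      · rintro (⟨j, hj, rfl⟩ | hw)
        · exact hj
        · exact hw.1
    dsimp only
    conv_lhs => rw [hsplit]
    rw [Set.ncard_union_eq ?_ (Set.toFinite _) (Set.toFinite _),
      Set.ncard_image_of_injective _ hv, ← Finset.card_filter, ← Set.ncard_coe_finset]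
    · simp
    · rw [Set.disjoint_left]
      rintro _ ⟨j, -, rfl⟩ h
      exact hG.notMem hX j h.2
  · intro i j h
    have : (H 0).Adj (v i) (v j) := by
      by_contra hc
      simp [hc] at h
    exact hirr 0 _ _ this
  · intro i j hij h
    have h0 : ¬ (H 0).Adj (v i) (v j) := by
      intro hc
      simp [hc] at h
    -- The two degrees of `v i` add up to `n - 1 + d i`, so distinct degrees in the second colour
    -- become a condition on those in the first.
    have h1 := (hor (hG.adj hv hX hij)).resolve_left h0
    have h2 := hirr 1 _ _ h1
    have h3 := hsum i
    have h4 := hsum j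
    dsimp only
    omega

theorem IsSplit.not_hasLocallyIrregularDecomposition_two_single {V : Type*} [Finite V]
    {G : SimpleGraph V} {X Y : Set V} (hG : G.IsSplit X Y) {n : ℕ} (hn4 : 4 ≤ n) (hn9 : n ≤ 9)
    {v : Fin n → V} (hv : Function.Injective v)
    (hX : Set.range v = X) {d : Fin n → ℕ} (hd : ∀ i, d i = G.degreeInto (v i) Y)
    (h0 : ∀ i, i.1 ≠ 0 → d i = 0) (h1 : ∀ i, d i < n / 2) :
    ¬ G.HasLocallyIrregularDecomposition 2 := by
  intro h
  obtain ⟨M, x, ρ, hsymm, hle, hdiag, hx, hρ, hr, hb⟩ := hG.exists_matrix hv hX hd h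
  obtain ⟨m, rfl⟩ : ∃ m, n = m + 1 := ⟨n - 1, by omega⟩
  have hds : ∀ i : Fin m, d i.succ = 0 := fun i => h0 _ (by simp)
  have hxs : ∀ i : Fin m, x i.succ = 0 := fun i => by
    have := hx i.succ
    rw [hds] at this
    omega
  refine singleInfeasible_sound (m := m) ?_ (singleInfeasible_of_le (m + 1) (by omega) hn4)
    (M := fun i j => M i.succ j.succ) (fun i j => hsymm _ _) (fun i j => hle _ _)
    (fun i => hdiag _) (α := fun i => M i.succ 0) (t := fun i => ρ i.succ) (fun i => hle _ _)
    ?_ ?_ (h1 0) (hx 0) (ρ := ρ 0) ?_ ?_ ?_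
  · intro p hp
    simp only [Nat.add_sub_cancel, List.mem_cons, List.not_mem_nil, or_false] at hp
    rcases hp with rfl | rfl <;> dsimp only <;> omega
  · intro i
    rw [hρ, hxs, Fin.sum_univ_succ, add_zero, add_comm]
  · intro i j hij
    by_contra hne
    have hne' : i.succ ≠ j.succ := fun h => hne (Fin.succ_injective _ h)
    have a1 := hr i.succ j.succ
    have a2 := hb i.succ j.succ hne'
    have a3 := hle i.succ j.succ
    rw [hds, hds] at a2
    dsimp only at hij
    omega
  · rw [hρ, Fin.sum_univ_succ, hdiag, zero_add]
    simp only [hsymm 0]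
  · exact fun i hi => hr _ _ hi
  · intro i hi
    have := hb i.succ 0 (Fin.succ_ne_zero _) hi
    rwa [hds, add_zero] at this

/-- The two special vertices have equally many outer neighbours, so whichever colour joins them
forces `ρ 0 ≠ ρ 1`; the same argument separates the degrees of all other clique vertices from one
another. -/
theorem IsSplit.not_hasLocallyIrregularDecomposition_two_pair {V : Type*} [Finite V]
    {G : SimpleGraph V} {X Y : Set V} (hG : G.IsSplit X Y) {n : ℕ} (hn6 : 6 ≤ n) (hn8 : n ≤ 8)
    {v : Fin n → V} (hv : Function.Injective v)
    (hX : Set.range v = X) {d : Fin n → ℕ} (hd : ∀ i, d i = G.degreeInto (v i) Y)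
    (h0 : ∀ i, 2 ≤ i.1 → d i = 0) (h1 : ∀ i, i.1 < 2 → d i = 1) :
    ¬ G.HasLocallyIrregularDecomposition 2 := by
  intro h
  obtain ⟨M, x, ρ, hsymm, hle, hdiag, hx, hρ, hr, hb⟩ := hG.exists_matrix hv hX hd h
  obtain ⟨m, rfl⟩ : ∃ m, n = m + 2 := ⟨n - 2, by omega⟩
  obtain ⟨ps, hps, hcheck⟩ : ∃ ps : List (ℕ × ℕ), (∀ p ∈ ps, p.1 + p.2 ≤ m) ∧
      pairInfeasible m ps = true := by
    obtain rfl | rfl | rfl : m = 4 ∨ m = 5 ∨ m = 6 := by omega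
    · exact ⟨_, by simp, pairInfeasible_four⟩
    · exact ⟨_, by simp, pairInfeasible_five⟩
    · exact ⟨_, by simp, pairInfeasible_six⟩
  have hds : ∀ i : Fin m, d i.succ.succ = 0 := fun i => h0 _ (by simp)
  have hd0 : d 0 = 1 := h1 _ (by simp)
  have hd1 : d 1 = 1 := h1 _ (by simp)
  have hxs : ∀ i : Fin m, x i.succ.succ = 0 := fun i => by
    have := hx i.succ.succ
    rw [hds] at this
    omega
  have hs1 : (Fin.succ 0 : Fin (m + 2)) = 1 := rfl
  have h01 : (0 : Fin (m + 2)) ≠ 1 := by simp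
  refine pairInfeasible_sound hps hcheck
    (M := fun i j => M i.succ.succ j.succ.succ) (fun i j => hsymm _ _) (fun i j => hle _ _)
    (fun i => hdiag _) (α := fun i => M i.succ.succ 0) (γ := fun i => M i.succ.succ 1)
    (t := fun i => ρ i.succ.succ) (fun i => hle _ _) (fun i => hle _ _)
    ?_ ?_ (hle 0 1) (hd0 ▸ hx 0) (hd1 ▸ hx 1) (ρ := ρ 0) (τ := ρ 1) ?_ ?_ ?_ ?_ ?_ ?_ ?_
  · intro i
    rw [hρ, hxs, Fin.sum_univ_succ, Fin.sum_univ_succ, hs1]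
    omega
  · intro i j hij
    by_contra hne
    have hne' : i.succ.succ ≠ j.succ.succ := fun h =>
      hne (Fin.succ_injective _ (Fin.succ_injective _ h))
    have a1 := hr i.succ.succ j.succ.succ
    have a2 := hb i.succ.succ j.succ.succ hne'
    have a3 := hle i.succ.succ j.succ.succ
    rw [hds, hds] at a2
    dsimp only at hij
    omega
  · rw [hρ, Fin.sum_univ_succ, Fin.sum_univ_succ, hdiag, hs1]
    simp only [hsymm 0 (Fin.succ _)]
    omega
  · rw [hρ, Fin.sum_univ_succ, Fin.sum_univ_succ, hs1, hdiag, hsymm 1 0]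
    simp only [hsymm 1 (Fin.succ _)]
    omega
  · have a1 := hr 0 1
    have a2 := hb 0 1 h01
    have a3 := hle 0 1
    omega
  · exact fun i hi => hr _ _ hi
  · intro i hi
    have := hb i.succ.succ 0 (Fin.succ_ne_zero _) hi
    rwa [hds, hd0, add_zero] at this
  · exact fun i hi => hr _ _ hi
  · intro i hi
    have := hb i.succ.succ 1 (hs1 ▸ (Fin.succ_injective _).ne (Fin.succ_ne_zero i)) hi
    rwa [hds, hd1, add_zero] at this

end LowerBound

/-! ### Undecomposable split graphs with two or three clique vertices. -/

section SmallCliques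

theorem IsSplit.not_decomposable_of_eq_zero {V : Type*} [Finite V] {G : SimpleGraph V}
    {X Y : Set V} (hG : G.IsSplit X Y) {n : ℕ} (hn2 : 2 ≤ n) (hn3 : n ≤ 3) {v : Fin n → V}
    (hv : Function.Injective v) (hX : Set.range v = X) {d : Fin n → ℕ}
    (hd : ∀ i, d i = G.degreeInto (v i) Y) (h0 : ∀ i, d i = 0) : ¬ G.Decomposable := by
  have hadj : ∀ a b, G.Adj a b ↔ ∃ i j, i ≠ j ∧ a = v i ∧ b = v j := by
    intro a b
    constructor
    · intro h
      obtain ⟨i, rfl⟩ | ha := hG.exists_or_mem hX a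
      · obtain ⟨j, rfl⟩ | hb := hG.exists_or_mem hX b
        · exact ⟨i, j, fun hij => h.ne (by rw [hij]), rfl, rfl⟩
        · have := one_le_of_adj hd hb h
          rw [h0] at this
          omega
      · obtain ⟨j, rfl⟩ | hb := hG.exists_or_mem hX b
        · have := one_le_of_adj hd ha h.symm
          rw [h0] at this
          omega
        · exact absurd h (hG.not_adj ha hb)
    · rintro ⟨i, j, hij, rfl, rfl⟩
      exact hG.adj hv hX hij
  obtain rfl | rfl : n = 2 ∨ n = 3 := by omega
  · refine not_decomposable_of_edge (a := v 0) (b := v 1) ?_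
    ext x
    induction x using Sym2.ind with
    | _ a b =>
      rw [mem_edgeSet, hadj]
      simp [Fin.exists_fin_succ]
  · refine not_decomposable_of_triangle (a := v 0) (b := v 1) (c := v 2) ?_
    ext x
    induction x using Sym2.ind with
    | _ a b =>
      rw [mem_edgeSet, hadj]
      simp [Fin.exists_fin_succ]
      tauto

theorem IsSplit.not_decomposable_of_eq_one {V : Type*} {G : SimpleGraph V}
    {X Y : Set V} (hG : G.IsSplit X Y) {v : Fin 2 → V}
    (hv : Function.Injective v) (hX : Set.range v = X) {d : Fin 2 → ℕ}
    (hd : ∀ i, d i = G.degreeInto (v i) Y) (h1 : ∀ i, d i = 1) : ¬ G.Decomposable := by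
  have hnb : ∀ i, ∃ y, G.neighborSet (v i) ∩ Y = {y} := by
    intro i
    rw [← Set.ncard_eq_one]
    exact (hd i).symm.trans (h1 i)
  choose y hy using hnb
  have hyY : ∀ i, G.Adj (v i) (y i) ∧ y i ∈ Y := by
    intro i
    have : y i ∈ G.neighborSet (v i) ∩ Y := by rw [hy]; rfl
    exact this
  have huniq : ∀ i z, z ∈ Y → G.Adj (v i) z → z = y i := by
    intro i z hz h
    have : z ∈ G.neighborSet (v i) ∩ Y := ⟨h, hz⟩
    rwa [hy] at this
  have h01 : G.Adj (v 0) (v 1) := hG.adj hv hX (by decide)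
  refine not_decomposable_of_path (a := y 0) (b := v 0) (c := v 1) (d := y 1) ?_ ?_ ?_ ?_
  · intro h
    exact hG.notMem hX 1 (h ▸ (hyY 0).2)
  · intro h
    -- A common outer neighbour would be adjacent to the whole clique, against its maximality.
    obtain ⟨i, hi⟩ := hG.exists_not_adj hX (hyY 0).2
    obtain rfl | rfl : i = 0 ∨ i = 1 := by omega
    · exact hi (hyY 0).1
    · exact hi (h ▸ (hyY 1).1)
  · intro h
    exact hG.notMem hX 0 (h ▸ (hyY 1).2)
  · ext x
    induction x using Sym2.ind with
    | _ a b =>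
      simp only [mem_edgeSet, Set.mem_insert_iff, Set.mem_singleton_iff, Sym2.eq_iff]
      constructor
      · intro h
        obtain ⟨i, rfl⟩ | ha := hG.exists_or_mem hX a
        · obtain ⟨j, rfl⟩ | hb := hG.exists_or_mem hX b
          · obtain rfl | rfl : i = 0 ∨ i = 1 := by omega
            · obtain rfl | rfl : j = 0 ∨ j = 1 := by omega
              · exact absurd rfl h.ne
              · simp
            · obtain rfl | rfl : j = 0 ∨ j = 1 := by omega
              · simp
              · exact absurd rfl h.ne
          · have := huniq i b hb h
            obtain rfl | rfl : i = 0 ∨ i = 1 := by omega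
            · simp [this]
            · simp [this]
        · obtain ⟨j, rfl⟩ | hb := hG.exists_or_mem hX b
          · have := huniq j a ha h.symm
            obtain rfl | rfl : j = 0 ∨ j = 1 := by omega
            · simp [this]
            · simp [this]
          · exact absurd h (hG.not_adj ha hb)
      · rintro ((⟨rfl, rfl⟩ | ⟨rfl, rfl⟩) | (⟨rfl, rfl⟩ | ⟨rfl, rfl⟩) |
          (⟨rfl, rfl⟩ | ⟨rfl, rfl⟩))
        exacts [(hyY 0).1.symm, (hyY 0).1, h01, h01.symm, (hyY 1).1, (hyY 1).1.symm]

end SmallCliques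

/-! ### The exceptional cases with two colours. -/

section Exceptional

theorem IsSplit.exists_decomposition_of_isIrregularColouring {V : Type*} [Finite V]
    {G : SimpleGraph V}
    {X Y : Set V} (hG : G.IsSplit X Y) {n : ℕ} {v : Fin n → V} (hv : Function.Injective v)
    (hX : Set.range v = X) {d : Fin n → ℕ} (hd : ∀ i, d i = G.degreeInto (v i) Y) {k : ℕ}
    {c : Fin n → Fin n → Fin k} (hc : ∀ i j, c i j = c j i) {e : Fin n → Fin k}
    (h : IsIrregularColouring d c e) : ∃ l ≤ k, G.HasLocallyIrregularDecomposition l :=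
  hG.exists_decomposition_of_colourDegree hv hX hd c hc e h.1 h.2

theorem sum_first_three_le {n : ℕ} (hn : 3 ≤ n) (d : Fin n → ℕ) :
    d ⟨0, by omega⟩ + d ⟨1, by omega⟩ + d ⟨2, by omega⟩ ≤ ∑ i, d i := by
  obtain ⟨m, rfl⟩ := Nat.exists_eq_add_of_le' hn
  rw [Fin.sum_univ_succ, Fin.sum_univ_succ, Fin.sum_univ_succ]
  exact (by omega : ∀ a b c s : ℕ, a + b + c ≤ a + (b + (c + s))) _ _ _ _

theorem IsSplit.exists_decomposition_two_of_sum_three {V : Type*} [Finite V]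
    {G : SimpleGraph V} {X Y : Set V} (hG : G.IsSplit X Y) {n : ℕ} (hn8 : 8 ≤ n) (hn9 : n ≤ 9)
    {v : Fin n → V} (hv : Function.Injective v)
    (hX : Set.range v = X) {d : Fin n → ℕ} (hd : ∀ i, d i = G.degreeInto (v i) Y)
    (hanti : Antitone d) (h3 : d ⟨0, by omega⟩ + d ⟨1, by omega⟩ + d ⟨2, by omega⟩ = 3)
    (h1 : 1 ≤ d ⟨1, by omega⟩) : ∃ l ≤ 2, G.HasLocallyIrregularDecomposition l := by
  by_cases hsum : n / 2 ≤ ∑ i, d i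
  · exact hG.exists_decomposition_two_of_le_sum (by omega) hn9 hv hX hd hanti hsum
      (Or.inl (by omega))
  -- The whole sum is now below `4`, so the first three values carry all of it: they are `1, 1, 1`
  -- or `2, 1, 0`.
  have h10 : d ⟨1, by omega⟩ ≤ d ⟨0, by omega⟩ := hanti (by simp)
  have h21 : d ⟨2, by omega⟩ ≤ d ⟨1, by omega⟩ := hanti (by simp)
  obtain rfl | rfl : n = 8 ∨ n = 9 := by omega
  · simp only [Fin.sum_univ_eight] at hsum
    change d 0 + d 1 + d 2 = 3 at h3
    change 1 ≤ d 1 at h1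
    change d 1 ≤ d 0 at h10
    change d 2 ≤ d 1 at h21
    obtain h | h : d 2 = 1 ∨ d 2 = 0 := by omega
    · have hdv : d = ![1, 1, 1, 0, 0, 0, 0, 0] := by
        ext i
        fin_cases i <;> simp <;> omega
      exact hG.exists_decomposition_of_isIrregularColouring hv hX hd
        (fun _ _ => flippedColour_comm _ _ _ _) (hdv ▸ isIrregularColouring_eight_one_one_one)
    · have hdv : d = ![2, 1, 0, 0, 0, 0, 0, 0] := by
        ext i
        fin_cases i <;> simp <;> omega
      exact hG.exists_decomposition_of_isIrregularColouring hv hX hd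
        (fun _ _ => flippedColour_comm _ _ _ _) (hdv ▸ isIrregularColouring_eight_two_one)
  · simp only [Fin.sum_univ_succ (n := 8), Fin.sum_univ_eight] at hsum
    simp at hsum
    change d 0 + d 1 + d 2 = 3 at h3
    change 1 ≤ d 1 at h1
    change d 1 ≤ d 0 at h10
    change d 2 ≤ d 1 at h21
    obtain h | h : d 2 = 1 ∨ d 2 = 0 := by omega
    · have hdv : d = ![1, 1, 1, 0, 0, 0, 0, 0, 0] := by
        ext i
        fin_cases i <;> simp <;> omega
      exact hG.exists_decomposition_of_isIrregularColouring hv hX hd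
        (fun _ _ => flippedColour_comm _ _ _ _) (hdv ▸ isIrregularColouring_nine_one_one_one)
    · have hdv : d = ![2, 1, 0, 0, 0, 0, 0, 0, 0] := by
        ext i
        fin_cases i <;> simp <;> omega
      exact hG.exists_decomposition_of_isIrregularColouring hv hX hd
        (fun _ _ => flippedColour_comm _ _ _ _) (hdv ▸ isIrregularColouring_nine_two_one)

theorem IsSplit.exists_decomposition_two_of_nine {V : Type*} [Finite V]
    {G : SimpleGraph V} {X Y : Set V} (hG : G.IsSplit X Y)
    {v : Fin 9 → V} (hv : Function.Injective v)
    (hX : Set.range v = X) {d : Fin 9 → ℕ} (hd : ∀ i, d i = G.degreeInto (v i) Y)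
    (hanti : Antitone d) (h0 : d 0 = 1) (h1 : d 1 = 1) :
    ∃ l ≤ 2, G.HasLocallyIrregularDecomposition l := by
  have h21 : d 2 ≤ d 1 := hanti (by decide)
  obtain h2 | h2 : d 2 = 1 ∨ d 2 = 0 := by omega
  · refine hG.exists_decomposition_two_of_sum_three (by omega) le_rfl hv hX hd hanti ?_ h1.ge
    change d 0 + d 1 + d 2 = 3
    omega
  · have hdv : d = ![1, 1, 0, 0, 0, 0, 0, 0, 0] := by
      have hz : ∀ i : Fin 9, 2 ≤ i → d i = 0 := fun i hi => by
        have := hanti hi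
        omega
      ext i
      fin_cases i
      · exact h0
      · exact h1
      all_goals exact hz _ (by decide)
    exact hG.exists_decomposition_of_isIrregularColouring hv hX hd
      (fun _ _ => flippedColour_comm _ _ _ _) (hdv ▸ isIrregularColouring_nine_one_one)

end Exceptional

end SimpleGraph

/-! ### The main theorem. -/

/-- The vertices `v_1, …, v_n` of the clique are `v 0, …, v (n-1)`, and `d_i` is `d (i-1)`. -/
theorem theorem2 {V : Type*} [Finite V] (G : SimpleGraph V) (X Y : Set V) (hG : G.IsSplit X Y)
    (n : ℕ) (hn2 : 2 ≤ n) (hn9 : n ≤ 9)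
    (v : Fin n → V) (hv : Function.Injective v) (hX : Set.range v = X)
    (d : Fin n → ℕ) (hd : ∀ i, d i = G.degreeInto (v i) Y) (hanti : Antitone d) :
    ((Nonempty (G ≃g SimpleGraph.completeGraph (Fin 2)) ∨
        Nonempty (G ≃g SimpleGraph.completeGraph (Fin 3)) ∨
        Nonempty (G ≃g SimpleGraph.pathGraph 4)) → ¬ G.Decomposable) ∧
    (G.Decomposable →
      (StrictAnti d → G.irregularChromaticIndex = 1) ∧
      (¬ StrictAnti d →
        (n / 2 ≤ ∑ i, d i → G.irregularChromaticIndex = 2) ∧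
        ((∃ h : 8 ≤ n, d ⟨0, by omega⟩ + d ⟨1, by omega⟩ + d ⟨2, by omega⟩ = 3 ∧
            1 ≤ d ⟨1, by omega⟩) → G.irregularChromaticIndex = 2) ∧
        (n = 9 ∧ d ⟨0, by omega⟩ = 1 ∧ d ⟨1, by omega⟩ = 1 → G.irregularChromaticIndex = 2) ∧
        (¬ (n / 2 ≤ ∑ i, d i) →
          ¬ (∃ h : 8 ≤ n, d ⟨0, by omega⟩ + d ⟨1, by omega⟩ + d ⟨2, by omega⟩ = 3 ∧
            1 ≤ d ⟨1, by omega⟩) →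
          ¬ (n = 9 ∧ d ⟨0, by omega⟩ = 1 ∧ d ⟨1, by omega⟩ = 1) →
          G.irregularChromaticIndex = 3))) := by
  have hanti' : ∀ i j : Fin n, i.1 ≤ j.1 → d j ≤ d i := fun i j hij => hanti hij
  refine ⟨SimpleGraph.not_decomposable_of_iso, fun hdec => ⟨fun hstrict => ?_, fun hns => ?_⟩⟩
  · refine SimpleGraph.irregularChromaticIndex_eq
      (hG.exists_decomposition_one hv hX hd hstrict.injective) fun l hl => ?_
    obtain rfl : l = 0 := by omega
    exact SimpleGraph.not_hasLocallyIrregularDecomposition_zero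
      (hG.adj hv hX (i := ⟨0, by omega⟩) (j := ⟨1, by omega⟩) (by simp))
  obtain ⟨i, j, hij, hdij⟩ : ∃ i j, i < j ∧ d i = d j := by
    by_contra! hne
    exact hns fun i j hij => lt_of_le_of_ne (hanti hij.le) (hne i j hij).symm
  have hlt2 : ∀ l < 2, ¬ G.HasLocallyIrregularDecomposition l := by
    intro l hl
    have hadj := hG.adj hv hX hij.ne
    obtain rfl | rfl : l = 0 ∨ l = 1 := by omega
    · exact SimpleGraph.not_hasLocallyIrregularDecomposition_zero hadj
    · intro h
      refine SimpleGraph.ncard_neighborSet_ne_of_hasLocallyIrregularDecomposition_one h hadj ?_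
      rw [hG.ncard_neighborSet hv hX hd, hG.ncard_neighborSet hv hX hd, hdij]
  refine ⟨fun hsum => ?_, ?_, ?_, fun hsum hc hd' => ?_⟩
  · refine SimpleGraph.irregularChromaticIndex_eq
      (hG.exists_decomposition_two_of_le_sum hn2 hn9 hv hX hd hanti hsum ?_) hlt2
    by_contra! hP
    obtain ⟨rfl, a, ha⟩ := hP
    refine hG.not_decomposable_of_eq_one hv hX hd (fun b => ?_) hdec
    have hb : b = i ∨ b = j := by omega
    have ha' : a = i ∨ a = j := by omega
    grind
  · rintro ⟨h8, h3, h1⟩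
    exact SimpleGraph.irregularChromaticIndex_eq
      (hG.exists_decomposition_two_of_sum_three h8 hn9 hv hX hd hanti h3 h1) hlt2
  · rintro ⟨rfl, h0, h1⟩
    exact SimpleGraph.irregularChromaticIndex_eq
      (hG.exists_decomposition_two_of_nine hv hX hd hanti h0 h1) hlt2
  · have hle : ∀ i, d i ≤ ∑ i, d i := fun i =>
      Finset.single_le_sum (fun _ _ => Nat.zero_le _) (Finset.mem_univ i)
    -- For `n ≤ 3` the sum is below `1`, so `G` has only the edges of `K_2` or `K_3`.
    have hn4 : 4 ≤ n := by
      by_contra hlt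
      refine hG.not_decomposable_of_eq_zero hn2 (by omega) hv hX hd (fun i => ?_) hdec
      have := hle i
      omega
    have h3 := SimpleGraph.sum_first_three_le (by omega) d
    have h10 : d ⟨1, by omega⟩ ≤ d ⟨0, by omega⟩ := hanti (by simp)
    have hlt3 : ¬ G.HasLocallyIrregularDecomposition 2 →
        ∀ l < 3, ¬ G.HasLocallyIrregularDecomposition l := by
      intro h2 l hl
      obtain h | rfl : l < 2 ∨ l = 2 := by omega
      · exact hlt2 l h
      · exact h2
    by_cases h1 : d ⟨1, by omega⟩ = 0
    · have hz : ∀ i : Fin n, i.1 ≠ 0 → d i = 0 := fun i hi => by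
        have := hanti' ⟨1, by omega⟩ i (by simp only; omega)
        omega
      have hdv : d = fun i => if i.1 = 0 then d ⟨0, by omega⟩ else 0 := by
        ext i
        split_ifs with hi
        · exact congrArg d (Fin.ext hi)
        · exact hz i hi
      have hk := hle ⟨0, by omega⟩
      refine SimpleGraph.irregularChromaticIndex_eq
        (hG.exists_decomposition_of_isIrregularColouring hv hX hd
          (c := fun i j => SimpleGraph.threeColour (n / 2) i j)
          (fun _ _ => SimpleGraph.threeColour_comm _ _ _) (e := fun _ => 0) ?_)
        (hlt3 (hG.not_hasLocallyIrregularDecomposition_two_single hn4 hn9 hv hX hd hz fun i => ?_))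
      · rw [hdv]
        exact SimpleGraph.isIrregularColouring_three_single n (by omega) hn4 _ (by omega)
      · have := hle i
        omega
    · have h8 : 8 ≤ n → d ⟨0, by omega⟩ + d ⟨1, by omega⟩ + d ⟨2, by omega⟩ ≠ 3 :=
        fun h8 h => hc ⟨h8, h, by omega⟩
      -- Here `2 ≤ d 0 + d 1`, and the sum is at most `2` for `n ≤ 7` and at most `3` for `n ≥ 8`,
      -- where a first-three sum of `3` is excluded.
      have h01 : d ⟨0, by omega⟩ = 1 ∧ d ⟨1, by omega⟩ = 1 ∧ d ⟨2, by omega⟩ = 0 := by omega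
      have hn9' : n ≠ 9 := fun h => hd' ⟨h, h01.1, h01.2.1⟩
      have hz : ∀ i : Fin n, 2 ≤ i.1 → d i = 0 := fun i hi => by
        have := hanti' ⟨2, by omega⟩ i hi
        omega
      have ho : ∀ i : Fin n, i.1 < 2 → d i = 1 := fun i hi => by
        obtain h | h : i.1 = 0 ∨ i.1 = 1 := by omega
        · rw [← h01.1]
          exact congrArg d (Fin.ext h)
        · rw [← h01.2.1]
          exact congrArg d (Fin.ext h)
      have hdv : d = fun i => if i.1 < 2 then 1 else 0 := by
        ext i
        split_ifs with hi
        · exact ho i hi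
        · exact hz i (by omega)
      refine SimpleGraph.irregularChromaticIndex_eq
        (hG.exists_decomposition_of_isIrregularColouring hv hX hd
          (c := fun i j => SimpleGraph.threeColour (n / 2) i j)
          (fun _ _ => SimpleGraph.threeColour_comm _ _ _) (e := fun _ => 0) ?_)
        (hlt3 (hG.not_hasLocallyIrregularDecomposition_two_pair (by omega) (by omega) hv hX hd
          hz ho))
      · rw [hdv]
        exact SimpleGraph.isIrregularColouring_three_pair n (by omega) (by omega)
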